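/- Let $\lambda_{\rm b},\lambda_{\rm p}>0$ and $\bar m\ge 0$. Let $\Phi_{\rm u}=\bigcup_{{\bf z}\in\Phi_{\rm p}}({\bf z}+\mathcal B^{\bf z})$ be a Poisson cluster process in $\mathbb R^2$: $\Phi_{\rm p}$ is a homogeneous Poisson point process of intensity $\lambda_{\rm p}$, and, independently of it, the $\mathcal B^{\bf z}$ are i.i.d. finite point processes, each having a ${\rm Poisson}(\bar m)$ number of points which are i.i.d. with density $f$. It is a Thomas cluster process (TCP) if $f({\bf s})=\frac{1}{2\pi\sigma^2}e^{-\|{\bf s}\|^2/(2\sigma^2)}$ with $\sigma>0$, and a Matérn cluster process (MCP) if $f$ is the uniform density on the disc of radius ${\tt R}>0$ centred at the origin $o$. Approximate the load of the typical cell of the Poisson–Voronoi tessellation of a Poisson process of intensity $\lambda_{\rm b}$ independent of $\Phi_{\rm u}$ by $N=\Phi_{\rm u}(b(o,R_{\rm c}))$, where $\pi R_{\rm c}^2=A$ is a random area independent of $\Phi_{\rm u}$ such that $\lambda_{\rm b}A$ is Gamma distributed with shape $3.5$ and rate $3.5$. Then $R_{\rm c}$ has the density $$f_{R_{\rm c}}(r)=\sqrt{\pi\lambda_{\rm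 b}}\;g\big(\sqrt{\pi\lambda_{\rm b}}\,r\big),\qquad g(x)=\frac{2\cdot 3.5^{3.5}}{\Gamma(3.5)}x^6e^{-3.5x^2},\qquad r,x>0.$$ In both cases below $N$ is almost surely finite, and for every $\theta\in\mathbb C$ with $|\theta|\le1$ its probability generating function $G(\theta)=\mathbb E[\theta^{N}]$ is $$G(\theta)=\int_0^\infty\exp\Big(-2\pi\lambda_{\rm p}\int_0^\infty\big(1-e^{-\bar m(1-\theta)\,p(r,v)}\big)v\,{\rm d}v\Big)f_{R_{\rm c}}(r)\,{\rm d}r ,$$ all integrals being absolutely convergent, where $p(r,v)$ is the probability that $\|{\bf z}+{\bf s}\|<r$ for $\|{\bf z}\|=v$ and ${\bf s}$ with density $f$, and is given as follows. (i) If $\Phi_{\rm u}$ is a TCP, then $p(r,v)=1-Q_1(v/\sigma,r/\sigma)$ for $r,v\ge0$, where $Q_1(\alpha,\beta)=\int_\beta^\infty y\,e^{-(y^2+\alpha^2)/2}I_0(\alpha y)\,{\rm d}y$ is the Marcum $Q$-function and $I_0$ is the modified Bessel function of the first kind of order zero. (ii) If $\Phi_{\rm u}$ is an MCP, then $p(r,v)=\xi(r,v)$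 for $r,v\ge0$, where $$\xi(r,v)=\frac1{{\tt R}^2}\bigg(\big[\min(r,\max({\tt R}-v,0))\big]^2+\frac2\pi\int_{\min(r,|{\tt R}-v|)}^{\min(r,{\tt R}+v)}u\arccos\Big(\frac{u^2+v^2-{\tt R}^2}{2uv}\Big){\rm d}u\bigg).$$ -/

import Mathlib

open MeasureTheory ProbabilityTheory Set
open scoped NNReal ENNReal

noncomputable section

/-- The Euclidean plane. -/
abbrev Plane : Type := EuclideanSpace ℝ (Fin 2)

/-- The point process (random counting measure) `Φ` on the plane is a Poisson point process with
intensity measure `Λ`: counts of sets of finite intensity are Poisson, and counts of disjoint sets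
are independent. -/
structure IsPoissonPointProcess {Ω : Type*} [MeasurableSpace Ω] (Φ : Ω → Measure Plane)
    (Λ : Measure Plane) (μ : Measure Ω) : Prop where
  measurable : Measurable Φ
  hasLaw_count : ∀ B : Set Plane, MeasurableSet B → Λ B ≠ ∞ →
    HasLaw (fun ω => Φ ω B)
      ((poissonMeasure (Λ B).toNNReal).map (fun n : ℕ => (n : ℝ≥0∞))) μ
  indep_count : ∀ (n : ℕ) (B : Fin n → Set Plane), (∀ i, MeasurableSet (B i)) →
    (∀ i, Λ (B i) ≠ ∞) → Pairwise (fun i j => Disjoint (B i) (B j)) →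
    iIndepFun (fun i ω => Φ ω (B i)) μ

/-- `Φ` is a Poisson cluster process with parent intensity `lamP`, mean cluster size `mbar` and
offspring density `f`: the parents `Z i` form a homogeneous Poisson point process of intensity
`lamP`; the `i`-th parent has `M i` offspring, at the points `Z i + S i j` with `j < M i`; the
cluster sizes `M i` are i.i.d. Poisson with mean `mbar`, the displacements `S i j` are i.i.d. with
density `f`, and parents, cluster sizes and displacements are mutually independent. -/
def IsPoissonClusterProcess {Ω : Type*} [MeasurableSpace Ω] (Φ : Ω → Measure Plane)
    (lamP mbar : ℝ≥0) (f : Plane → ℝ) (μ : Measure Ω) : Prop :=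
  ∃ (Z : ℕ → Ω → Plane) (M : ℕ → Ω → ℕ) (S : ℕ → ℕ → Ω → Plane),
    (∀ i, Measurable (Z i)) ∧ (∀ i, Measurable (M i)) ∧ (∀ i j, Measurable (S i j)) ∧
    IsPoissonPointProcess (fun ω => Measure.sum fun i => Measure.dirac (Z i ω))
      (lamP • volume) μ ∧
    (∀ i, HasLaw (M i) (poissonMeasure mbar) μ) ∧ iIndepFun M μ ∧
    (∀ i j, HasLaw (S i j) (volume.withDensity fun s => ENNReal.ofReal (f s)) μ) ∧
    iIndepFun (fun (p : ℕ × ℕ) ω => S p.1 p.2 ω) μ ∧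
    IndepFun (fun ω i => M i ω) (fun ω (p : ℕ × ℕ) => S p.1 p.2 ω) μ ∧
    IndepFun (fun ω i => Z i ω)
      (fun ω => ((fun i => M i ω, fun p => S p.1 p.2 ω) : (ℕ → ℕ) × (ℕ × ℕ → Plane))) μ ∧
    ∀ ω, Φ ω = Measure.sum fun i => ∑ j ∈ Finset.range (M i ω), Measure.dirac (Z i ω + S i j ω)

/-- Offspring density of the Thomas cluster process with cluster variance `σ ^ 2`. -/
def thomasPDF (σ : ℝ) (s : Plane) : ℝ :=
  1 / (2 * Real.pi * σ ^ 2) * Real.exp (-‖s‖ ^ 2 / (2 * σ ^ 2))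

open Classical in
/-- Offspring density of the Matérn cluster process: uniform on the disc of radius `R`. -/
def maternPDF (R : ℝ) (s : Plane) : ℝ :=
  if ‖s‖ ≤ R then 1 / (Real.pi * R ^ 2) else 0

/-- `Φ` is a Thomas cluster process. -/
def IsThomasClusterProcess {Ω : Type*} [MeasurableSpace Ω] (Φ : Ω → Measure Plane)
    (lamP mbar : ℝ≥0) (σ : ℝ) (μ : Measure Ω) : Prop :=
  IsPoissonClusterProcess Φ lamP mbar (thomasPDF σ) μ

/-- `Φ` is a Matérn cluster process. -/
def IsMaternClusterProcess {Ω : Type*} [MeasurableSpace Ω] (Φ : Ω → Measure Plane)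
    (lamP mbar : ℝ≥0) (R : ℝ) (μ : Measure Ω) : Prop :=
  IsPoissonClusterProcess Φ lamP mbar (maternPDF R) μ

/-- Modified Bessel function of the first kind of order zero. -/
def besselI0 (x : ℝ) : ℝ := ∑' k : ℕ, (x / 2) ^ (2 * k) / ((k.factorial : ℝ) ^ 2)

/-- Marcum Q-function of order one. -/
def marcumQ1 (α β : ℝ) : ℝ :=
  ∫ y in Ioi β, y * Real.exp (-(y ^ 2 + α ^ 2) / 2) * besselI0 (α * y)

/-- The function `ξ(r, v)` for the Matérn cluster process with cluster radius `R`. -/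
def maternXi (R r v : ℝ) : ℝ :=
  1 / R ^ 2 * ((min r (max (R - v) 0)) ^ 2 +
    2 / Real.pi * ∫ u in (min r |R - v|)..(min r (R + v)),
      u * Real.arccos ((u ^ 2 + v ^ 2 - R ^ 2) / (2 * u * v)))

/-- Radius of the disc (centred at the origin) of area `a`. -/
def equivRadius (a : ℝ) : ℝ := √(a / Real.pi)

/-- Nakagami density with parameters `m = 3.5`, `Ω = 1`. -/
def nakagamiPDF (x : ℝ) : ℝ :=
  2 * (3.5 : ℝ) ^ (3.5 : ℝ) / Real.Gamma 3.5 * x ^ 6 * Real.exp (-(3.5 * x ^ 2))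

/-- Density of the radius `r` of the equal-area disc: `√(π lamB) r` is Nakagami distributed. -/
def equivRadiusPDF (lamB r : ℝ) : ℝ :=
  √(Real.pi * lamB) * nakagamiPDF (√(Real.pi * lamB) * r)

/-- Number of points of `Φ` in the disc centred at the origin whose area is the random area `A`:
the load of the typical cell when the cell, of area `A`, is replaced by a disc of the same area. -/
def discLoad {Ω : Type*} (Φ : Ω → Measure Plane) (A : Ω → ℝ) (ω : Ω) : ℕ :=
  ⌊(Φ ω (Metric.ball 0 (equivRadius (A ω)))).toReal⌋₊

/-- The function `v ↦ (1 - exp (-mbar (1 - θ) p v)) v`, where `p v` is the probability that an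
offspring of a parent at distance `v` from the origin lies in a given disc centred at the origin. -/
def clusterIntegrand (mbar : ℝ) (p : ℝ → ℝ) (θ : ℂ) (v : ℝ) : ℂ :=
  (1 - Complex.exp (-(mbar : ℂ) * (1 - θ) * (p v : ℂ))) * (v : ℂ)

/-- The function
`r ↦ exp (-2 π lamP ∫_0^∞ (1 - exp (-mbar (1 - θ) p r v)) v dv) f_{R_c}(r)`. -/
def loadPGFIntegrand (lamB lamP mbar : ℝ) (p : ℝ → ℝ → ℝ) (θ : ℂ) (r : ℝ) : ℂ :=
  Complex.exp (-2 * (Real.pi : ℂ) * (lamP : ℂ) *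
    ∫ v in Ioi (0 : ℝ), clusterIntegrand mbar (p r) θ v) * (equivRadiusPDF lamB r : ℂ)

end

/-! The area is independent of the cluster process, so conditioning on it gives G(θ) = E[g(R_c)],
where g(r) = E[θ^Φ(b(o,r))] is the generating function for a deterministic disc. It remains to
compute g, the law of R_c, and the hitting probability p.

For a set B of finite volume, fix the parents. An offspring of a parent at z contributes the mean
factor 1 - (1-θ)p(z), with p(z) the probability that it lands in B. A Poisson number of independent
offspring turns this into exp(-c p(z)), with c = mbar(1-θ), and the parents multiply to exp(-c Σ
p(Z_i)) (`integral_prod_prod_cluster`). The Laplace functional of the parent process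
(`IsPoissonPointProcess.integral_exp_lintegral`) then yields exp(-lamP ∫ (1 - exp(-c p(z))) dz),
which is `IsPoissonClusterProcess.integral_pow_count`. The condition |θ| ≤ 1 enters as Re c ≥ 0,
whence |exp(-cp)| ≤ 1 and |1 - exp(-cp)| ≤ |c|p. As ∫ p = |B|, all integrals converge.

For a disc, p is radial, and polar coordinates give the integral against 2πv dv. The substitution x
= π lamB r² in the Gamma density gives the law of R_c; `IsPoissonClusterProcess.discLoad_pgf`
combines these facts. Finally p is found by integrating the displacement density along circles about
the origin: the angular integral is I₀ in the Gaussian case (`thomasPDF_real_norm_add_lt`) and an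
arc length in the uniform case (`maternPDF_real_norm_add_lt`). -/

open Filter Topology

/-! ### Fubini for independent random variables -/

section Independence

variable {Ω α β : Type*} [MeasurableSpace Ω] [MeasurableSpace α] [MeasurableSpace β]
  {μ : Measure Ω} [IsProbabilityMeasure μ] {X : Ω → α} {Y : Ω → β}

lemma ProbabilityTheory.IndepFun.lintegral_eq_lintegral_lintegral (h : IndepFun X Y μ)
    (hX : AEMeasurable X μ) (hY : AEMeasurable Y μ) {F : α × β → ℝ≥0∞} (hF : Measurable F) :
    ∫⁻ ω, F (X ω, Y ω) ∂μ = ∫⁻ ω, ∫⁻ ω', F (X ω, Y ω') ∂μ ∂μ := by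
  have hmap := h.map_prod_eq_prod_map_map hX hY
  have h1 : ∫⁻ ω, F (X ω, Y ω) ∂μ = ∫⁻ q, F q ∂(μ.map X).prod (μ.map Y) := by
    rw [← hmap, lintegral_map' hF.aemeasurable (hX.prodMk hY)]
  have : IsProbabilityMeasure (μ.map Y) := Measure.isProbabilityMeasure_map hY
  rw [h1, lintegral_prod _ hF.aemeasurable, lintegral_map' _ hX]
  · refine lintegral_congr fun ω => ?_
    rw [lintegral_map' _ hY]
    exact (hF.comp measurable_prodMk_left).aemeasurable
  · exact hF.lintegral_prod_right'.aemeasurable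

lemma ProbabilityTheory.IndepFun.integral_eq_integral_integral (h : IndepFun X Y μ)
    (hX : AEMeasurable X μ) (hY : AEMeasurable Y μ) {F : α × β → ℂ} (hF : Measurable F)
    (hb : ∀ q, ‖F q‖ ≤ 1) :
    ∫ ω, F (X ω, Y ω) ∂μ = ∫ ω, ∫ ω', F (X ω, Y ω') ∂μ ∂μ := by
  have hmap := h.map_prod_eq_prod_map_map hX hY
  have h1 : ∫ ω, F (X ω, Y ω) ∂μ = ∫ q, F q ∂(μ.map X).prod (μ.map Y) := by
    rw [← hmap, integral_map (hX.prodMk hY) hF.aestronglyMeasurable]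
  have : IsProbabilityMeasure (μ.map Y) := Measure.isProbabilityMeasure_map hY
  have : IsProbabilityMeasure (μ.map X) := Measure.isProbabilityMeasure_map hX
  rw [h1, integral_prod, integral_map hX]
  · refine integral_congr_ae (ae_of_all _ fun ω => ?_)
    dsimp only
    rw [integral_map hY]
    exact (hF.comp measurable_prodMk_left).aestronglyMeasurable
  · exact hF.stronglyMeasurable.integral_prod_right'.aestronglyMeasurable
  · exact Integrable.of_bound hF.aestronglyMeasurable 1 (ae_of_all _ hb)

end Independence

/-! ### Generating function and mean of the Poisson law -/

section Poisson

lemma integral_pow_poissonMeasure (r : ℝ≥0) (q : ℂ) :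
    ∫ n, q ^ n ∂(poissonMeasure r) = Complex.exp (-(r : ℂ) * (1 - q)) := by
  rw [integral_poissonMeasure]
  have h : ∀ n : ℕ, (Real.exp (-r) * (r : ℝ) ^ n / n.factorial) • q ^ n =
      Complex.exp (-(r : ℂ)) * (((r : ℂ) * q) ^ n / n.factorial) := by
    intro n
    rw [Complex.real_smul]
    push_cast
    rw [mul_pow]
    ring
  simp_rw [h]
  rw [tsum_mul_left, ← (NormedSpace.expSeries_div_hasSum_exp ((r : ℂ) * q)).tsum_eq.symm,
    ← Complex.exp_eq_exp_ℂ, ← Complex.exp_add]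
  ring_nf

lemma lintegral_natCast_poissonMeasure (r : ℝ≥0) :
    ∫⁻ n, (n : ℝ≥0∞) ∂(poissonMeasure r) = r := by
  have h1 : ∑' n : ℕ, ENNReal.ofReal (Real.exp (-r) * (r : ℝ) ^ n / n.factorial) = 1 := by
    have h := measure_univ (μ := poissonMeasure r)
    rw [poissonMeasure, Measure.sum_apply _ MeasurableSet.univ] at h
    simpa using h
  rw [poissonMeasure, lintegral_sum_measure]
  simp_rw [lintegral_smul_measure, lintegral_dirac]
  rw [tsum_eq_zero_add' ENNReal.summable]
  have h2 : ∀ n : ℕ, ENNReal.ofReal (Real.exp (-r) * (r : ℝ) ^ (n + 1) / (n + 1).factorial) •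
      ((n + 1 : ℕ) : ℝ≥0∞) =
      r * ENNReal.ofReal (Real.exp (-r) * (r : ℝ) ^ n / n.factorial) := by
    intro n
    rw [smul_eq_mul, ← ENNReal.ofReal_natCast (n + 1), ← ENNReal.ofReal_coe_nnreal (p := r),
      ← ENNReal.ofReal_mul (by positivity), ← ENNReal.ofReal_mul (by positivity)]
    congr 1
    rw [Nat.factorial_succ]
    push_cast
    field_simp
    ring
  simp_rw [h2]
  rw [ENNReal.tsum_mul_left, h1]
  simp

end Poisson

/-! ### Bounds for the exponential on the left half-plane -/

section ComplexExp

lemma norm_exp_neg_mul_ofReal_le_one {c : ℂ} (hc : 0 ≤ c.re) {x : ℝ} (hx : 0 ≤ x) :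
    ‖Complex.exp (-c * x)‖ ≤ 1 := by
  rw [Complex.norm_exp, Real.exp_le_one_iff]
  simp only [Complex.mul_re, Complex.neg_re, Complex.ofReal_re, Complex.ofReal_im, mul_zero,
    sub_zero]
  nlinarith

/-- Mean value inequality on the convex half-plane Re z ≤ 0, where the derivative of exp has norm at
most 1. -/
lemma Complex.norm_one_sub_exp_neg_le {w : ℂ} (hw : 0 ≤ w.re) : ‖1 - Complex.exp (-w)‖ ≤ ‖w‖ := by
  have hconv : Convex ℝ {z : ℂ | z.re ≤ 0} := convex_halfSpace_re_le 0
  have h := hconv.norm_image_sub_le_of_norm_hasDerivWithin_le (f := Complex.exp)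
    (f' := Complex.exp) (C := 1) (x := -w) (y := 0)
    (fun z _ => (Complex.hasDerivAt_exp z).hasDerivWithinAt)
    (fun z (hz : z.re ≤ 0) => by rw [Complex.norm_exp]; exact Real.exp_le_one_iff.mpr hz)
    (s := {z : ℂ | z.re ≤ 0}) (by simpa [Set.mem_ofPred_eq] using hw) (by simp [Set.mem_ofPred_eq])
  simpa using h

lemma norm_one_sub_exp_neg_mul_ofReal_le {c : ℂ} (hc : 0 ≤ c.re) {x : ℝ} (hx : 0 ≤ x) :
    ‖1 - Complex.exp (-c * x)‖ ≤ ‖c‖ * x := by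
  have h := Complex.norm_one_sub_exp_neg_le (w := c * x)
    (by simp only [Complex.mul_re, Complex.ofReal_re, Complex.ofReal_im, mul_zero, sub_zero]
        positivity)
  rwa [← neg_mul, norm_mul, Complex.norm_real, Real.norm_of_nonneg hx] at h

end ComplexExp

/-! ### Counts and mean measure of a Poisson point process -/

section PoissonPointProcess

variable {Ω : Type*} [MeasurableSpace Ω] {μ : Measure Ω} {Ψ : Ω → Measure Plane}
  {Λ : Measure Plane}

lemma IsPoissonPointProcess.lintegral_count (hΨ : IsPoissonPointProcess Ψ Λ μ) {B : Set Plane}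
    (hB : MeasurableSet B) (hΛ : Λ B ≠ ∞) : ∫⁻ ω, Ψ ω B ∂μ = Λ B := by
  have h := (hΨ.hasLaw_count B hB hΛ).lintegral_comp (f := id) aemeasurable_id
  simp only [id] at h
  rw [h, lintegral_map (f := fun x => x) measurable_id (by fun_prop)]
  rw [lintegral_natCast_poissonMeasure, ENNReal.coe_toNNReal hΛ]

/-- Campbell's formula: the mean measure of `Ψ` is `Λ`. Count laws are given only on sets of finite
intensity, so other sets are exhausted by spanning sets. -/
lemma IsPoissonPointProcess.lintegral_lintegral [SigmaFinite Λ]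
    (hΨ : IsPoissonPointProcess Ψ Λ μ) {p : Plane → ℝ≥0∞} (hp : Measurable p) :
    ∫⁻ ω, ∫⁻ z, p z ∂(Ψ ω) ∂μ = ∫⁻ z, p z ∂Λ := by
  rw [← Measure.lintegral_bind hΨ.measurable.aemeasurable hp.aemeasurable]
  congr 1
  ext B hB
  have h1 : ∀ ν : Measure Plane, ν B = ⨆ n, ν (B ∩ spanningSets Λ n) := by
    intro ν
    rw [← Monotone.measure_iUnion (fun i j hij =>
      inter_subset_inter_right _ (monotone_spanningSets Λ hij)), ← inter_iUnion,
      iUnion_spanningSets, inter_univ]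
  rw [h1, h1 Λ]
  congr 1
  ext n
  have hBn : MeasurableSet (B ∩ spanningSets Λ n) := hB.inter (measurableSet_spanningSets Λ n)
  rw [Measure.bind_apply hBn hΨ.measurable.aemeasurable, hΨ.lintegral_count hBn]
  exact ((measure_mono inter_subset_right).trans_lt (measure_spanningSets_lt_top Λ n)).ne

lemma IsPoissonPointProcess.integral_exp_count (hΨ : IsPoissonPointProcess Ψ Λ μ) {B : Set Plane}
    (hB : MeasurableSet B) (hΛ : Λ B ≠ ∞) (c : ℂ) :
    ∫ ω, Complex.exp (-c * (Ψ ω B).toReal) ∂μ =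
      Complex.exp (-((Λ B).toReal : ℂ) * (1 - Complex.exp (-c))) := by
  have hm : Measurable fun x : ℝ≥0∞ => Complex.exp (-c * x.toReal) := by fun_prop
  have h := (hΨ.hasLaw_count B hB hΛ).integral_comp (f := fun x => Complex.exp (-c * x.toReal))
    hm.aestronglyMeasurable
  simp only [Function.comp_def] at h
  rw [h, integral_map (by fun_prop) hm.aestronglyMeasurable]
  simp only [ENNReal.toReal_natCast]
  have h2 : ∀ n : ℕ, Complex.exp (-c * ((n : ℝ) : ℂ)) = Complex.exp (-c) ^ n := by
    intro n
    rw [← Complex.exp_nat_mul]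
    push_cast
    ring_nf
  simp_rw [h2]
  rw [integral_pow_poissonMeasure]
  rfl

lemma IsPoissonPointProcess.ae_count_ne_top (hΨ : IsPoissonPointProcess Ψ Λ μ) {B : Set Plane}
    (hB : MeasurableSet B) (hΛ : Λ B ≠ ∞) : ∀ᵐ ω ∂μ, Ψ ω B ≠ ∞ := by
  have h := ae_lt_top (μ := μ) (f := fun ω => Ψ ω B)
    ((Measure.measurable_coe hB).comp hΨ.measurable) (by rwa [hΨ.lintegral_count hB hΛ])
  exact h.mono fun ω hω => hω.ne

end PoissonPointProcess

/-! ### Laplace functional of a Poisson point process -/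

section LaplaceFunctional

variable {Ω : Type*} [MeasurableSpace Ω] {μ : Measure Ω} {Ψ : Ω → Measure Plane}
  {Λ : Measure Plane}

/-- The level sets are disjoint, so their counts are independent Poisson variables and the
expectation factors. -/
lemma IsPoissonPointProcess.integral_exp_simpleFunc (hΨ : IsPoissonPointProcess Ψ Λ μ)
    (f : SimpleFunc Plane ℝ≥0∞) (hf : ∀ z, f z ≠ ∞) (hint : ∫⁻ z, f z ∂Λ ≠ ∞) (c : ℂ) :
    ∫ ω, Complex.exp (-c * (∫⁻ z, f z ∂(Ψ ω)).toReal) ∂μ =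
      Complex.exp (-∫ z, (1 - Complex.exp (-c * (f z).toReal)) ∂Λ) := by
  classical
  -- The value `0` is dropped: its level set may have infinite intensity, and it contributes to
  -- neither side.
  set s : Finset ℝ≥0∞ := f.range.filter (· ≠ 0) with hs
  let e := s.equivFin
  let a : Fin s.card → ℝ≥0∞ := fun i => (e.symm i : ℝ≥0∞)
  let B : Fin s.card → Set Plane := fun i => f ⁻¹' {a i}
  have ha_mem : ∀ i, a i ∈ s := fun i => (e.symm i).2
  have ha0 : ∀ i, a i ≠ 0 := fun i => (Finset.mem_filter.mp (ha_mem i)).2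
  have hinj : Function.Injective a := Subtype.val_injective.comp e.symm.injective
  have ha_top : ∀ i, a i ≠ ∞ := by
    intro i
    obtain ⟨z, hz⟩ := SimpleFunc.mem_range.mp (Finset.mem_filter.mp (ha_mem i)).1
    rw [← hz]
    exact hf z
  have hBm : ∀ i, MeasurableSet (B i) := fun i => f.measurableSet_preimage _
  have hsupp : f.FinMeasSupp Λ :=
    SimpleFunc.FinMeasSupp.of_lintegral_ne_top (by rwa [← SimpleFunc.lintegral_eq_lintegral])
  have hBΛ : ∀ i, Λ (B i) ≠ ∞ := fun i =>
    (hsupp.meas_preimage_singleton_ne_zero (ha0 i)).ne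
  have hdisj : Pairwise fun i j => Disjoint (B i) (B j) := by
    intro i j hij
    refine Disjoint.preimage _ ?_
    rw [disjoint_singleton]
    exact hinj.ne hij
  have hsum : ∀ {M : Type} [AddCommMonoid M] (g : ℝ≥0∞ → M),
      ∑ x ∈ s, g x = ∑ i, g (a i) := by
    intro M _ g
    rw [← Finset.sum_coe_sort s g]
    exact (Equiv.sum_comp e.symm fun x : s => g x).symm
  have hlint : ∀ ν : Measure Plane, ∫⁻ z, f z ∂ν = ∑ i, a i * ν (B i) := by
    intro ν
    rw [SimpleFunc.lintegral_eq_lintegral, SimpleFunc.lintegral,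
      ← hsum fun x => x * ν (f ⁻¹' {x}), hs, Finset.sum_filter_of_ne]
    rintro x - hx rfl
    simp at hx
  have hae : ∀ᵐ ω ∂μ, (∫⁻ z, f z ∂(Ψ ω)).toReal = ∑ i, (a i).toReal * (Ψ ω (B i)).toReal := by
    filter_upwards [ae_all_iff.mpr fun i => hΨ.ae_count_ne_top (hBm i) (hBΛ i)] with ω hω
    rw [hlint, ENNReal.toReal_sum fun i _ => ENNReal.mul_ne_top (ha_top i) (hω i)]
    simp_rw [ENNReal.toReal_mul]
  have hexp : ∀ᵐ ω ∂μ, Complex.exp (-c * (∫⁻ z, f z ∂(Ψ ω)).toReal) =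
      ∏ i, Complex.exp (-(c * (a i).toReal) * (Ψ ω (B i)).toReal) := by
    filter_upwards [hae] with ω hω
    rw [hω, ← Complex.exp_sum]
    congr 1
    push_cast
    rw [Finset.mul_sum]
    exact Finset.sum_congr rfl fun i _ => by ring
  have hind : ∀ z, (1 - Complex.exp (-c * (f z).toReal)) =
      ∑ i, (B i).indicator (fun _ => 1 - Complex.exp (-(c * (a i).toReal))) z := by
    intro z
    by_cases hz : f z = 0
    · rw [Finset.sum_eq_zero]
      · simp [hz]
      · intro i _
        refine indicator_of_notMem (s := B i) (fun hzi : f z = a i => ha0 i (hzi ▸ hz)) _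
    · have hzs : f z ∈ s := Finset.mem_filter.mpr ⟨SimpleFunc.mem_range_self f z, hz⟩
      have hza : a (e ⟨f z, hzs⟩) = f z := by simp [a]
      rw [Finset.sum_eq_single (e ⟨f z, hzs⟩)]
      · rw [indicator_of_mem (show z ∈ B _ from hza.symm), hza]
        ring_nf
      · intro i _ hi
        refine indicator_of_notMem (s := B i) (fun hzi : f z = a i => hi (hinj ?_)) _
        rw [hza, hzi]
      · simp
  rw [integral_congr_ae hexp]
  simp_rw [hind]
  rw [integral_finsetSum _ fun i _ =>
    (integrable_indicator_iff (hBm i)).mpr (integrableOn_const (hBΛ i))]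
  rw [(hΨ.indep_count _ B hBm hBΛ hdisj).integral_fun_prod_comp
    (f := fun i x => Complex.exp (-(c * (a i).toReal) * (x.toReal : ℂ)))
    (fun i => ((Measure.measurable_coe (hBm i)).comp hΨ.measurable).aemeasurable)
    (fun i => Measurable.aestronglyMeasurable (by fun_prop))]
  simp_rw [hΨ.integral_exp_count (hBm _) (hBΛ _)]
  rw [← Complex.exp_sum, ← Finset.sum_neg_distrib]
  congr 1
  refine Finset.sum_congr rfl fun i _ => ?_
  rw [integral_indicator_const _ (hBm i), Complex.real_smul, Measure.real]
  ring

/-- The Laplace functional of a Poisson point process, with a complex parameter. -/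
theorem IsPoissonPointProcess.integral_exp_lintegral [SigmaFinite Λ] [IsProbabilityMeasure μ]
    (hΨ : IsPoissonPointProcess Ψ Λ μ) {p : Plane → ℝ≥0∞} (hp : Measurable p)
    (hint : ∫⁻ z, p z ∂Λ ≠ ∞) {c : ℂ} (hc : 0 ≤ c.re) :
    ∫ ω, Complex.exp (-c * (∫⁻ z, p z ∂(Ψ ω)).toReal) ∂μ =
      Complex.exp (-∫ z, (1 - Complex.exp (-c * (p z).toReal)) ∂Λ) := by
  -- Simple functions increase to `p`. The left side is dominated by `1` because Re c ≥ 0, the right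
  -- side by `‖c‖ * p`.
  have hle : ∀ n z, SimpleFunc.eapprox p n z ≤ p z := fun n z => by
    rw [← SimpleFunc.iSup_eapprox_apply hp z]
    exact le_iSup (fun n => SimpleFunc.eapprox p n z) n
  have hn_int : ∀ n, ∫⁻ z, SimpleFunc.eapprox p n z ∂Λ ≠ ∞ := fun n =>
    ne_top_of_le_ne_top hint (lintegral_mono (hle n))
  have hn := fun n => hΨ.integral_exp_simpleFunc (SimpleFunc.eapprox p n)
    (fun z => (SimpleFunc.eapprox_lt_top p n z).ne) (hn_int n) c
  have hmeas : ∀ {g : Plane → ℝ≥0∞}, Measurable g →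
      Measurable fun ω => Complex.exp (-c * (∫⁻ z, g z ∂(Ψ ω)).toReal) := by
    intro g hg
    have := (Measure.measurable_lintegral hg).comp hΨ.measurable
    have h2 : Measurable fun ω => (∫⁻ z, g z ∂(Ψ ω)).toReal := this.ennreal_toReal
    fun_prop
  -- Finiteness makes `toReal` continuous at the limit.
  have hfin : ∀ᵐ ω ∂μ, ∫⁻ z, p z ∂(Ψ ω) < ∞ :=
    ae_lt_top ((Measure.measurable_lintegral hp).comp hΨ.measurable)
      (by rwa [hΨ.lintegral_lintegral hp])
  have hlim1 : Tendsto
      (fun n => ∫ ω, Complex.exp (-c * (∫⁻ z, SimpleFunc.eapprox p n z ∂(Ψ ω)).toReal) ∂μ) atTop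
      (𝓝 (∫ ω, Complex.exp (-c * (∫⁻ z, p z ∂(Ψ ω)).toReal) ∂μ)) := by
    refine tendsto_integral_of_dominated_convergence (fun _ => 1)
      (fun n => (hmeas (SimpleFunc.eapprox p n).measurable).aestronglyMeasurable)
      (integrable_const 1)
      (fun n => ae_of_all _ fun ω => norm_exp_neg_mul_ofReal_le_one hc ENNReal.toReal_nonneg) ?_
    filter_upwards [hfin] with ω hω
    have h1 : Tendsto (fun n => ∫⁻ z, SimpleFunc.eapprox p n z ∂(Ψ ω)) atTop
        (𝓝 (∫⁻ z, p z ∂(Ψ ω))) :=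
      lintegral_tendsto_of_tendsto_of_monotone
        (fun n => (SimpleFunc.eapprox p n).measurable.aemeasurable)
        (ae_of_all _ fun z _ _ h => SimpleFunc.monotone_eapprox p h z)
        (ae_of_all _ fun z => SimpleFunc.tendsto_eapprox hp z)
    have h2 := (ENNReal.tendsto_toReal hω.ne).comp h1
    have hcont : Continuous fun x : ℝ => Complex.exp (-c * x) := by fun_prop
    exact (hcont.tendsto _).comp h2
  have hp_fin : ∀ᵐ z ∂Λ, p z < ∞ := ae_lt_top hp hint
  have hlim2 : Tendsto
      (fun n => ∫ z, (1 - Complex.exp (-c * (SimpleFunc.eapprox p n z).toReal)) ∂Λ) atTop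
      (𝓝 (∫ z, (1 - Complex.exp (-c * (p z).toReal)) ∂Λ)) := by
    refine tendsto_integral_of_dominated_convergence (fun z => ‖c‖ * (p z).toReal)
      (fun n => ?_) ((integrable_toReal_of_lintegral_ne_top hp.aemeasurable hint).const_mul _)
      (fun n => ?_) ?_
    · have := (SimpleFunc.eapprox p n).measurable
      exact Measurable.aestronglyMeasurable (by fun_prop)
    · filter_upwards [hp_fin] with z hz
      refine (norm_one_sub_exp_neg_mul_ofReal_le hc ENNReal.toReal_nonneg).trans ?_
      gcongr
      · exact hz.ne
      · exact hle n z
    · filter_upwards [hp_fin] with z hz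
      have h2 := (ENNReal.tendsto_toReal hz.ne).comp (SimpleFunc.tendsto_eapprox hp z)
      have hcont : Continuous fun x : ℝ => 1 - Complex.exp (-c * x) := by fun_prop
      exact (hcont.tendsto _).comp h2
  simp_rw [hn] at hlim1
  exact tendsto_nhds_unique hlim1 ((Complex.continuous_exp.tendsto _).comp hlim2.neg)

end LaplaceFunctional

/-! ### Measurability of products and sums of random length -/

lemma Measurable.prod_range {α β : Type*} [MeasurableSpace α] [MeasurableSpace β] [CommMonoid β]
    [MeasurableMul₂ β] {k : α → ℕ} {g : ℕ → α → β} (hk : Measurable k)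
    (hg : ∀ j, Measurable (g j)) : Measurable fun x => ∏ j ∈ Finset.range (k x), g j x := by
  have h : Measurable fun q : ℕ × α => ∏ j ∈ Finset.range q.1, g j q.2 :=
    measurable_from_prod_countable_right fun k =>
      Finset.measurable_prod (Finset.range k) fun j _ => hg j
  exact h.comp (hk.prodMk measurable_id)

lemma Measurable.sum_range {α β : Type*} [MeasurableSpace α] [MeasurableSpace β] [AddCommMonoid β]
    [MeasurableAdd₂ β] {k : α → ℕ} {g : ℕ → α → β} (hk : Measurable k)
    (hg : ∀ j, Measurable (g j)) : Measurable fun x => ∑ j ∈ Finset.range (k x), g j x := by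
  have h : Measurable fun q : ℕ × α => ∑ j ∈ Finset.range q.1, g j q.2 :=
    measurable_from_prod_countable_right fun k =>
      Finset.measurable_sum (Finset.range k) fun j _ => hg j
  exact h.comp (hk.prodMk measurable_id)

/-- The probability that a parent at `z` places an offspring with displacement law `ν` in `B`. -/
noncomputable def hitProb (ν : Measure Plane) (B : Set Plane) (z : Plane) : ℝ≥0∞ :=
  ν {s | z + s ∈ B}

/-! ### Hitting probabilities -/

section HitProb

variable {ν : Measure Plane} {B : Set Plane}

lemma measurableSet_add_mem (hB : MeasurableSet B) (z : Plane) :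
    MeasurableSet {s | z + s ∈ B} := measurable_const_add z hB

lemma measurable_hitProb [SFinite ν] (hB : MeasurableSet B) : Measurable (hitProb ν B) :=
  measurable_measure_prodMk_left (measurable_add hB : MeasurableSet ((fun q : Plane × Plane =>
    q.1 + q.2) ⁻¹' B))

lemma hitProb_le_one [IsProbabilityMeasure ν] (z : Plane) : hitProb ν B z ≤ 1 := prob_le_one

lemma hitProb_ne_top [IsProbabilityMeasure ν] (z : Plane) : hitProb ν B z ≠ ∞ :=
  ne_top_of_le_ne_top ENNReal.one_ne_top (hitProb_le_one z)

/-- Tonelli on the set of pairs with z + s in `B`: for fixed s the slice is a translate of `B`, and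
`ν` has mass one. -/
lemma lintegral_hitProb [IsProbabilityMeasure ν] (hB : MeasurableSet B) :
    ∫⁻ z, hitProb ν B z = volume B := by
  have hB' : MeasurableSet ((fun q : Plane × Plane => q.1 + q.2) ⁻¹' B) := measurable_add hB
  have h1 := Measure.prod_apply (μ := (volume : Measure Plane)) (ν := ν) hB'
  have h2 := Measure.prod_apply_symm (μ := (volume : Measure Plane)) (ν := ν) hB'
  have h3 : ∀ s : Plane, volume ((fun z : Plane => (z, s)) ⁻¹'
      ((fun q : Plane × Plane => q.1 + q.2) ⁻¹' B)) = volume B :=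
    fun s => measure_preimage_add_right volume s B
  simp_rw [h3] at h2
  rw [lintegral_const, measure_univ, mul_one] at h2
  rw [← h2, h1]
  rfl

end HitProb

/-! ### Generating function of the first n clusters -/

section FiniteClusters

variable {Ω : Type*} [MeasurableSpace Ω] {μ : Measure Ω}
  {Z : ℕ → Ω → Plane} {M : ℕ → Ω → ℕ} {S : ℕ → ℕ → Ω → Plane} {ν : Measure Plane}
  {B : Set Plane} {mbar : ℝ≥0} {θ : ℂ}

lemma integral_prod_pow_clusterSize (hMm : ∀ i, Measurable (M i))
    (hMlaw : ∀ i, HasLaw (M i) (poissonMeasure mbar) μ) (hMind : iIndepFun M μ) (q : ℕ → ℂ)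
    (n : ℕ) :
    ∫ ω, ∏ i ∈ Finset.range n, q i ^ M i ω ∂μ =
      ∏ i ∈ Finset.range n, Complex.exp (-(mbar : ℂ) * (1 - q i)) := by
  have h := (hMind.precomp (g := fun x : Finset.range n => x.1)
    Subtype.val_injective).integral_fun_prod_comp
    (f := fun (x : Finset.range n) (k : ℕ) => q x.1 ^ k)
    (fun x => (hMm x.1).aemeasurable) (fun x => Measurable.of_discrete.aestronglyMeasurable)
  have hR : ∀ i, ∫ ω, q i ^ M i ω ∂μ = Complex.exp (-(mbar : ℂ) * (1 - q i)) := by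
    intro i
    rw [← integral_pow_poissonMeasure]
    exact (hMlaw i).integral_comp (f := fun k => q i ^ k)
      Measurable.of_discrete.aestronglyMeasurable
  simp_rw [hR] at h
  rw [Finset.prod_coe_sort (Finset.range n) fun i => Complex.exp (-(mbar : ℂ) * (1 - q i))] at h
  rw [← h]
  refine integral_congr_ae (ae_of_all _ fun ω => ?_)
  dsimp only
  rw [Finset.prod_coe_sort (Finset.range n) fun i => q i ^ M i ω]

variable [IsProbabilityMeasure μ]

open Classical in
lemma integral_ite_add_mem {X : Ω → Plane} (hX : Measurable X) (hlaw : HasLaw X ν μ)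
    (hB : MeasurableSet B) (θ : ℂ) (z : Plane) :
    ∫ ω, (if z + X ω ∈ B then θ else 1) ∂μ = 1 - (1 - θ) * (hitProb ν B z).toReal := by
  have hT : MeasurableSet {ω | z + X ω ∈ B} := hX (measurableSet_add_mem hB z)
  have h1 : ∀ ω, (if z + X ω ∈ B then θ else 1) =
      1 - {ω | z + X ω ∈ B}.indicator (fun _ => 1 - θ) ω := by
    intro ω
    by_cases h : z + X ω ∈ B <;> simp [indicator, h]
  simp_rw [h1]
  rw [integral_sub (integrable_const _) ((integrable_const _).indicator hT),
    integral_indicator_const _ hT, integral_const, probReal_univ]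
  have h2 : μ {ω | z + X ω ∈ B} = hitProb ν B z :=
    hlaw.measure_eq (p := fun s => z + s ∈ B) (measurableSet_add_mem hB z)
  rw [Measure.real, h2, Complex.real_smul]
  simp [mul_comm]

-- The double product is flattened to one product over a finite set of index pairs, so that joint
-- independence of the displacements applies at once.
open Classical in
lemma integral_prod_prod_displacement (hSm : ∀ i j, Measurable (S i j))
    (hSlaw : ∀ i j, HasLaw (S i j) ν μ)
    (hSind : iIndepFun (fun (p : ℕ × ℕ) ω => S p.1 p.2 ω) μ) (hB : MeasurableSet B) (θ : ℂ)
    (z : ℕ → Plane) (m : ℕ → ℕ) (n : ℕ) :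
    ∫ ω, ∏ i ∈ Finset.range n, ∏ j ∈ Finset.range (m i),
        (if z i + S i j ω ∈ B then θ else 1) ∂μ =
      ∏ i ∈ Finset.range n, (1 - (1 - θ) * (hitProb ν B (z i)).toReal : ℂ) ^ m i := by
  set t : Finset (Σ _ : ℕ, ℕ) := (Finset.range n).sigma fun i => Finset.range (m i)
  have hinj : Function.Injective fun x : t => (x.1.1, x.1.2) := by
    rintro ⟨⟨a, b⟩, hx⟩ ⟨⟨c, d⟩, hy⟩ h
    simp only [Prod.mk.injEq] at h
    obtain ⟨rfl, rfl⟩ := h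
    rfl
  have hw : ∀ z : Plane, Measurable fun s : Plane => if z + s ∈ B then θ else 1 := fun z =>
    Measurable.ite (measurableSet_add_mem hB z) measurable_const measurable_const
  have h := (hSind.precomp hinj).integral_fun_prod_comp
    (f := fun (x : t) (s : Plane) => if z x.1.1 + s ∈ B then θ else 1)
    (fun x => (hSm x.1.1 x.1.2).aemeasurable) (fun x => (hw _).aestronglyMeasurable)
  have hR : ∀ x : t, ∫ ω, (if z x.1.1 + S x.1.1 x.1.2 ω ∈ B then θ else 1) ∂μ =
      1 - (1 - θ) * (hitProb ν B (z x.1.1)).toReal := fun x =>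
    integral_ite_add_mem (hSm _ _) (hSlaw _ _) hB θ _
  simp only at h
  simp_rw [hR] at h
  rw [Finset.prod_coe_sort t fun x => (1 - (1 - θ) * ((hitProb ν B (z x.1)).toReal : ℂ)),
    Finset.prod_sigma] at h
  simp only [Finset.prod_const, Finset.card_range] at h
  rw [← h]
  refine integral_congr_ae (ae_of_all _ fun ω => ?_)
  dsimp only
  rw [Finset.prod_coe_sort t fun x => (if z x.1 + S x.1 x.2 ω ∈ B then θ else 1),
    Finset.prod_sigma]

-- With the parents and cluster sizes fixed, displacements are integrated out first, then the sizes;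
-- the parents remain random on the right, ready for the Laplace functional.
open Classical in
lemma integral_prod_prod_cluster (hZm : ∀ i, Measurable (Z i)) (hMm : ∀ i, Measurable (M i))
    (hSm : ∀ i j, Measurable (S i j)) (hMlaw : ∀ i, HasLaw (M i) (poissonMeasure mbar) μ)
    (hMind : iIndepFun M μ) (hSlaw : ∀ i j, HasLaw (S i j) ν μ)
    (hSind : iIndepFun (fun (p : ℕ × ℕ) ω => S p.1 p.2 ω) μ)
    (hMS : IndepFun (fun ω i => M i ω) (fun ω (p : ℕ × ℕ) => S p.1 p.2 ω) μ)
    (hZMS : IndepFun (fun ω i => Z i ω)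
      (fun ω => ((fun i => M i ω, fun p => S p.1 p.2 ω) : (ℕ → ℕ) × (ℕ × ℕ → Plane))) μ)
    (hB : MeasurableSet B) (hθ : ‖θ‖ ≤ 1) (n : ℕ) :
    ∫ ω, ∏ i ∈ Finset.range n, ∏ j ∈ Finset.range (M i ω),
        (if Z i ω + S i j ω ∈ B then θ else 1) ∂μ =
      ∫ ω, Complex.exp (-((mbar : ℂ) * (1 - θ)) *
        (∑ i ∈ Finset.range n, (hitProb ν B (Z i ω)).toReal : ℝ)) ∂μ := by
  have hw : Measurable fun s : Plane => if s ∈ B then θ else 1 :=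
    Measurable.ite hB measurable_const measurable_const
  have hw1 : ∀ s : Plane, ‖if s ∈ B then θ else 1‖ ≤ 1 := by
    intro s
    split_ifs <;> simp [hθ]
  have hZ' : Measurable fun ω i => Z i ω := measurable_pi_lambda _ hZm
  have hM' : Measurable fun ω i => M i ω := measurable_pi_lambda _ hMm
  have hS' : Measurable fun ω (p : ℕ × ℕ) => S p.1 p.2 ω :=
    measurable_pi_lambda _ fun p => hSm p.1 p.2
  let F : (ℕ → Plane) × ((ℕ → ℕ) × (ℕ × ℕ → Plane)) → ℂ := fun x =>
    ∏ i ∈ Finset.range n, ∏ j ∈ Finset.range (x.2.1 i),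
      (if x.1 i + x.2.2 (i, j) ∈ B then θ else 1)
  have hF : Measurable F := by
    refine Finset.measurable_prod _ fun i _ => Measurable.prod_range (by fun_prop) fun j => ?_
    exact hw.comp (by fun_prop)
  have hF1 : ∀ x, ‖F x‖ ≤ 1 := by
    intro x
    rw [norm_prod]
    refine Finset.prod_le_one (fun _ _ => norm_nonneg _) fun i _ => ?_
    rw [norm_prod]
    exact Finset.prod_le_one (fun _ _ => norm_nonneg _) fun j _ => hw1 _
  have h1 := hZMS.integral_eq_integral_integral hZ'.aemeasurable
    (hM'.prodMk hS').aemeasurable hF hF1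
  refine h1.trans (integral_congr_ae (ae_of_all _ fun ω => ?_))
  have h2 := hMS.integral_eq_integral_integral hM'.aemeasurable hS'.aemeasurable
    (F := fun y => F (fun i => Z i ω, y)) (hF.comp measurable_prodMk_left) fun y => hF1 _
  refine h2.trans ?_
  have h3 : ∀ ω', ∫ ω'', F (fun i => Z i ω, (fun i => M i ω', fun p => S p.1 p.2 ω'')) ∂μ =
      ∏ i ∈ Finset.range n, (1 - (1 - θ) * (hitProb ν B (Z i ω)).toReal : ℂ) ^ M i ω' :=
    fun ω' => integral_prod_prod_displacement hSm hSlaw hSind hB θ (fun i => Z i ω)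
      (fun i => M i ω') n
  simp_rw [h3]
  rw [integral_prod_pow_clusterSize hMm hMlaw hMind, ← Complex.exp_sum]
  push_cast
  rw [Finset.mul_sum]
  congr 1
  exact Finset.sum_congr rfl fun i _ => by ring

end FiniteClusters

/-- A finite sum of natural numbers in `ℝ≥0∞` is eventually equal to its partial sums. -/
lemma ENNReal.exists_tsum_natCast_eq {K : ℕ → ℕ} (h : ∑' i, (K i : ℝ≥0∞) ≠ ∞) :
    ∃ n₀, ∀ n ≥ n₀, ∑' i, (K i : ℝ≥0∞) = ((∑ i ∈ Finset.range n, K i : ℕ) : ℝ≥0∞) := by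
  -- The terms tend to `0`, and a natural number below `1` is `0`, so only finitely many terms
  -- survive.
  have h0 := ENNReal.tendsto_atTop_zero_of_tsum_ne_top h
  obtain ⟨n₀, hn₀⟩ := eventually_atTop.mp (h0.eventually_lt_const one_pos)
  refine ⟨n₀, fun n hn => ?_⟩
  rw [tsum_eq_sum (s := Finset.range n)]
  · push_cast
    rfl
  · intro i hi
    have h1 := hn₀ i (hn.trans (by simpa using hi))
    have h2 : K i < 1 := by exact_mod_cast h1
    simp [Nat.lt_one_iff.mp h2]

lemma re_mul_one_sub_nonneg (mbar : ℝ≥0) {θ : ℂ} (hθ : ‖θ‖ ≤ 1) :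
    0 ≤ (((mbar : ℝ) : ℂ) * (1 - θ)).re := by
  have h1 : θ.re ≤ 1 := (Complex.re_le_norm θ).trans hθ
  rw [Complex.re_ofReal_mul, Complex.sub_re, Complex.one_re]
  exact mul_nonneg mbar.2 (by linarith)

/-! ### Mean count and generating function of a Poisson cluster process -/

section ClusterProcess

variable {Ω : Type*} [MeasurableSpace Ω] {μ : Measure Ω}
  {Φ : Ω → Measure Plane} {lamP mbar : ℝ≥0} {f : Plane → ℝ} {B : Set Plane}

open Classical in
lemma sum_dirac_apply_eq_tsum (Z : ℕ → Plane) (M : ℕ → ℕ) (S : ℕ → ℕ → Plane)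
    (hB : MeasurableSet B) :
    (Measure.sum fun i => ∑ j ∈ Finset.range (M i), Measure.dirac (Z i + S i j)) B =
      ∑' i, ((∑ j ∈ Finset.range (M i), if Z i + S i j ∈ B then 1 else 0 : ℕ) : ℝ≥0∞) := by
  rw [Measure.sum_apply _ hB]
  congr 1
  ext i
  rw [Measure.finsetSum_apply]
  push_cast
  refine Finset.sum_congr rfl fun j _ => ?_
  rw [Measure.dirac_apply' _ hB]
  by_cases h : Z i + S i j ∈ B <;> simp [h]

lemma IsPoissonClusterProcess.measurable (hΦ : IsPoissonClusterProcess Φ lamP mbar f μ) :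
    Measurable Φ := by
  obtain ⟨Z, M, S, hZm, hMm, hSm, -, -, -, -, -, -, -, hΦ⟩ := hΦ
  refine Measure.measurable_of_measurable_coe _ fun B hB => ?_
  simp_rw [hΦ, sum_dirac_apply_eq_tsum _ _ _ hB]
  refine Measurable.tsum fun i => ?_
  refine (Measurable.of_discrete (f := ((↑) : ℕ → ℝ≥0∞))).comp
    ((hMm i).sum_range fun j => ?_)
  exact Measurable.ite (((hZm i).add (hSm i j)) hB) measurable_const measurable_const

lemma IsPoissonClusterProcess.exists_natCast (hΦ : IsPoissonClusterProcess Φ lamP mbar f μ)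
    (hB : MeasurableSet B) {ω : Ω} (hω : Φ ω B ≠ ∞) : ∃ k : ℕ, Φ ω B = k := by
  obtain ⟨Z, M, S, -, -, -, -, -, -, -, -, -, -, hΦ⟩ := hΦ
  rw [hΦ, sum_dirac_apply_eq_tsum _ _ _ hB] at hω ⊢
  obtain ⟨n₀, h⟩ := ENNReal.exists_tsum_natCast_eq hω
  exact ⟨_, h n₀ le_rfl⟩

variable [IsProbabilityMeasure μ]

/-- Being the law of a random displacement forces mass one, so `f` needs no separate normalisation.
-/
lemma IsPoissonClusterProcess.isProbabilityMeasure
    (hΦ : IsPoissonClusterProcess Φ lamP mbar f μ) :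
    IsProbabilityMeasure (volume.withDensity fun s : Plane => ENNReal.ofReal (f s)) := by
  obtain ⟨Z, M, S, -, -, -, -, -, -, hSlaw, -⟩ := hΦ
  exact (hSlaw 0 0).isProbabilityMeasure_iff.mp inferInstance

/-- The mean number of points of a Poisson cluster process in a set. -/
lemma IsPoissonClusterProcess.lintegral_count (hΦ : IsPoissonClusterProcess Φ lamP mbar f μ)
    (hB : MeasurableSet B) : ∫⁻ ω, Φ ω B ∂μ = mbar * (lamP * volume B) := by
  classical
  have hprob := hΦ.isProbabilityMeasure
  obtain ⟨Z, M, S, hZm, hMm, hSm, hΨ, hMlaw, -, hSlaw, -, hMS, hZMS, hΦ⟩ := hΦ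
  set ν := volume.withDensity fun s : Plane => ENNReal.ofReal (f s)
  have hZ' : Measurable fun ω i => Z i ω := measurable_pi_lambda _ hZm
  have hM' : Measurable fun ω i => M i ω := measurable_pi_lambda _ hMm
  have hS' : Measurable fun ω (p : ℕ × ℕ) => S p.1 p.2 ω :=
    measurable_pi_lambda _ fun p => hSm p.1 p.2
  have hw : Measurable fun s : Plane => if s ∈ B then 1 else 0 :=
    Measurable.ite hB measurable_const measurable_const
  let F : (ℕ → Plane) × ((ℕ → ℕ) × (ℕ × ℕ → Plane)) → ℝ≥0∞ := fun x =>
    ∑' i, ((∑ j ∈ Finset.range (x.2.1 i), if x.1 i + x.2.2 (i, j) ∈ B then 1 else 0 : ℕ) : ℝ≥0∞)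
  have hF : Measurable F := by
    refine Measurable.tsum fun i => ?_
    refine (Measurable.of_discrete (f := ((↑) : ℕ → ℝ≥0∞))).comp
      (Measurable.sum_range (by fun_prop) fun j => ?_)
    exact hw.comp (by fun_prop)
  have h1 := hZMS.lintegral_eq_lintegral_lintegral hZ'.aemeasurable
    (hM'.prodMk hS').aemeasurable hF
  have h2 := fun ω => hMS.lintegral_eq_lintegral_lintegral hM'.aemeasurable hS'.aemeasurable
    (F := fun y => F (fun i => Z i ω, y)) (hF.comp measurable_prodMk_left)
  -- Averaging over the displacements alone leaves the cluster size times the hitting probability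
  -- for each parent; the sizes then have mean `mbar`, and Campbell's formula handles the parents.
  have h3 : ∀ ω ω', ∫⁻ ω'', F (fun i => Z i ω, (fun i => M i ω', fun p => S p.1 p.2 ω'')) ∂μ =
      ∑' i, (M i ω' : ℝ≥0∞) * hitProb ν B (Z i ω) := by
    intro ω ω'
    have hmeas : ∀ i j, MeasurableSet {ω'' | Z i ω + S i j ω'' ∈ B} := fun i j =>
      hSm i j (measurableSet_add_mem hB (Z i ω))
    have hF' : ∀ ω'', F (fun i => Z i ω, (fun i => M i ω', fun p => S p.1 p.2 ω'')) =
        ∑' i, ∑ j ∈ Finset.range (M i ω'),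
          {ω'' | Z i ω + S i j ω'' ∈ B}.indicator (1 : Ω → ℝ≥0∞) ω'' := by
      intro ω''
      simp only [F]
      congr 1
      ext i
      push_cast
      refine Finset.sum_congr rfl fun j _ => ?_
      by_cases h : Z i ω + S i j ω'' ∈ B <;> simp [h, indicator]
    simp_rw [hF']
    rw [lintegral_tsum fun i => (Finset.measurable_sum _ fun j _ =>
      measurable_one.indicator (hmeas i j)).aemeasurable]
    congr 1
    ext i
    rw [lintegral_finsetSum _ fun j _ => measurable_one.indicator (hmeas i j)]
    have h4 : ∀ j, μ {ω'' | Z i ω + S i j ω'' ∈ B} = hitProb ν B (Z i ω) := fun j =>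
      (hSlaw i j).measure_eq (p := fun s => Z i ω + s ∈ B) (measurableSet_add_mem hB _)
    simp_rw [lintegral_indicator_one (hmeas i _), h4]
    rw [Finset.sum_const, Finset.card_range, nsmul_eq_mul]
  have h5 : ∀ i, ∫⁻ ω, (M i ω : ℝ≥0∞) ∂μ = mbar := by
    intro i
    rw [← lintegral_natCast_poissonMeasure]
    exact (hMlaw i).lintegral_comp (f := fun k => (k : ℝ≥0∞)) Measurable.of_discrete.aemeasurable
  have h6 : ∫⁻ ω, Φ ω B ∂μ = ∫⁻ ω, F (fun i => Z i ω, (fun i => M i ω, fun p => S p.1 p.2 ω)) ∂μ := by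
    refine lintegral_congr fun ω => ?_
    rw [hΦ, sum_dirac_apply_eq_tsum _ _ _ hB]
  have h7 : ∀ ω, ∫⁻ z, hitProb ν B z ∂(Measure.sum fun i => Measure.dirac (Z i ω)) =
      ∑' i, hitProb ν B (Z i ω) := by
    intro ω
    rw [lintegral_sum_measure]
    simp_rw [lintegral_dirac' _ (measurable_hitProb (ν := ν) hB)]
  rw [h6, h1]
  simp_rw [h2, h3]
  have h8 : ∀ ω, ∫⁻ ω', ∑' i, (M i ω' : ℝ≥0∞) * hitProb ν B (Z i ω) ∂μ =
      mbar * ∫⁻ z, hitProb ν B z ∂(Measure.sum fun i => Measure.dirac (Z i ω)) := by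
    intro ω
    have hMe : ∀ i, Measurable fun ω' => (M i ω' : ℝ≥0∞) := fun i =>
      (Measurable.of_discrete (f := ((↑) : ℕ → ℝ≥0∞))).comp (hMm i)
    rw [lintegral_tsum fun i => ((hMe i).mul_const _).aemeasurable, h7, ← ENNReal.tsum_mul_left]
    congr 1
    ext i
    rw [lintegral_mul_const _ (hMe i), h5]
  simp_rw [h8]
  rw [lintegral_const_mul' _ _ ENNReal.coe_ne_top, hΨ.lintegral_lintegral (measurable_hitProb hB),
    lintegral_smul_measure, lintegral_hitProb hB]
  rfl

lemma IsPoissonClusterProcess.ae_count_ne_top (hΦ : IsPoissonClusterProcess Φ lamP mbar f μ)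
    (hB : MeasurableSet B) (hvol : volume B ≠ ∞) : ∀ᵐ ω ∂μ, Φ ω B ≠ ∞ := by
  have h := ae_lt_top (μ := μ) (f := fun ω => Φ ω B)
    ((Measure.measurable_coe hB).comp hΦ.measurable) (by
      rw [hΦ.lintegral_count hB]
      exact ENNReal.mul_ne_top ENNReal.coe_ne_top (ENNReal.mul_ne_top ENNReal.coe_ne_top hvol))
  exact h.mono fun ω hω => hω.ne

/-- The probability generating function of the number of points of a Poisson cluster process in a
set of finite volume. -/
theorem IsPoissonClusterProcess.integral_pow_count (hΦ : IsPoissonClusterProcess Φ lamP mbar f μ)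
    (hB : MeasurableSet B) (hvol : volume B ≠ ∞) {θ : ℂ} (hθ : ‖θ‖ ≤ 1) :
    ∫ ω, θ ^ ⌊(Φ ω B).toReal⌋₊ ∂μ =
      Complex.exp (-(lamP : ℂ) * ∫ z, (1 - Complex.exp (-((mbar : ℂ) * (1 - θ)) *
        (hitProb (volume.withDensity fun s => ENNReal.ofReal (f s)) B z).toReal))) := by
  classical
  have hprob := hΦ.isProbabilityMeasure
  have hfin := hΦ.ae_count_ne_top hB hvol
  obtain ⟨Z, M, S, hZm, hMm, hSm, hΨ, hMlaw, hMind, hSlaw, hSind, hMS, hZMS, hΦ⟩ := hΦ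
  set ν := volume.withDensity fun s : Plane => ENNReal.ofReal (f s)
  have hc : 0 ≤ ((mbar : ℂ) * (1 - θ)).re := re_mul_one_sub_nonneg mbar hθ
  have hw : Measurable fun s : Plane => if s ∈ B then θ else 1 :=
    Measurable.ite hB measurable_const measurable_const
  have hint : ∫⁻ z, hitProb ν B z ∂(lamP • volume : Measure Plane) ≠ ∞ := by
    rw [lintegral_smul_measure, lintegral_hitProb hB]
    exact ENNReal.mul_ne_top ENNReal.coe_ne_top hvol
  have hLap := hΨ.integral_exp_lintegral (measurable_hitProb hB) hint hc
  have hfinP := ae_lt_top ((Measure.measurable_lintegral (measurable_hitProb (ν := ν) hB)).comp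
    hΨ.measurable) (by rwa [← hΨ.lintegral_lintegral (measurable_hitProb hB)] at hint)
  have h7 : ∀ ω, ∫⁻ z, hitProb ν B z ∂(Measure.sum fun i => Measure.dirac (Z i ω)) =
      ∑' i, hitProb ν B (Z i ω) := by
    intro ω
    rw [lintegral_sum_measure]
    simp_rw [lintegral_dirac' _ (measurable_hitProb (ν := ν) hB)]
  have hstep := integral_prod_prod_cluster hZm hMm hSm hMlaw hMind hSlaw hSind hMS hZMS hB hθ
  -- The total count is almost surely finite, so the partial products are eventually constant, equal
  -- to the full power of θ.
  have hlim1 : Tendsto (fun n => ∫ ω, ∏ i ∈ Finset.range n, ∏ j ∈ Finset.range (M i ω),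
      (if Z i ω + S i j ω ∈ B then θ else 1) ∂μ) atTop
      (𝓝 (∫ ω, θ ^ ⌊(Φ ω B).toReal⌋₊ ∂μ)) := by
    refine tendsto_integral_of_dominated_convergence (fun _ => 1) (fun n => ?_)
      (integrable_const 1) (fun n => ae_of_all _ fun ω => ?_) ?_
    · refine Measurable.aestronglyMeasurable (Finset.measurable_prod _ fun i _ =>
        (hMm i).prod_range fun j => ?_)
      exact hw.comp ((hZm i).add (hSm i j))
    · rw [norm_prod]
      refine Finset.prod_le_one (fun _ _ => norm_nonneg _) fun i _ => ?_
      rw [norm_prod]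
      refine Finset.prod_le_one (fun _ _ => norm_nonneg _) fun j _ => ?_
      split_ifs <;> simp [hθ]
    · filter_upwards [hfin] with ω hω
      rw [hΦ, sum_dirac_apply_eq_tsum _ _ _ hB] at hω ⊢
      obtain ⟨n₀, hn₀⟩ := ENNReal.exists_tsum_natCast_eq hω
      refine tendsto_const_nhds.congr' ?_
      filter_upwards [eventually_ge_atTop n₀] with n hn
      rw [hn₀ n hn, ENNReal.toReal_natCast, Nat.floor_natCast, ← Finset.prod_pow_eq_pow_sum]
      refine Finset.prod_congr rfl fun i _ => ?_
      rw [← Finset.prod_pow_eq_pow_sum]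
      refine Finset.prod_congr rfl fun j _ => ?_
      split_ifs <;> simp
  -- The same partial products, averaged over clusters, converge to the Laplace functional of the
  -- parents.
  have hlim2 : Tendsto (fun n => ∫ ω, Complex.exp (-((mbar : ℂ) * (1 - θ)) *
      (∑ i ∈ Finset.range n, (hitProb ν B (Z i ω)).toReal : ℝ)) ∂μ) atTop
      (𝓝 (∫ ω, Complex.exp (-((mbar : ℂ) * (1 - θ)) *
        (∫⁻ z, hitProb ν B z ∂(Measure.sum fun i => Measure.dirac (Z i ω))).toReal) ∂μ)) := by
    refine tendsto_integral_of_dominated_convergence (fun _ => 1) (fun n => ?_)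
      (integrable_const 1) (fun n => ae_of_all _ fun ω => norm_exp_neg_mul_ofReal_le_one hc
        (Finset.sum_nonneg fun i _ => ENNReal.toReal_nonneg)) ?_
    · have h1 : Measurable fun ω => ∑ i ∈ Finset.range n, (hitProb ν B (Z i ω)).toReal :=
        Finset.measurable_sum _ fun i _ =>
          ((measurable_hitProb (ν := ν) hB).comp (hZm i)).ennreal_toReal
      exact Measurable.aestronglyMeasurable (by fun_prop)
    · filter_upwards [hfinP] with ω hω
      have hω' : ∫⁻ z, hitProb ν B z ∂(Measure.sum fun i => Measure.dirac (Z i ω)) ≠ ∞ := hω.ne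
      rw [h7] at hω' ⊢
      have h2 := (ENNReal.tendsto_toReal hω').comp
        (ENNReal.tendsto_nat_tsum fun i => hitProb ν B (Z i ω))
      have h3 : ∀ n, (∑ i ∈ Finset.range n, hitProb ν B (Z i ω)).toReal =
          ∑ i ∈ Finset.range n, (hitProb ν B (Z i ω)).toReal := fun n =>
        ENNReal.toReal_sum fun i _ => hitProb_ne_top _
      have hcont : Continuous fun x : ℝ => Complex.exp (-((mbar : ℂ) * (1 - θ)) * x) := by fun_prop
      have h4 := (hcont.tendsto _).comp h2
      simp only [Function.comp_def, h3] at h4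
      exact h4
  simp_rw [hstep] at hlim1
  rw [tendsto_nhds_unique hlim1 hlim2, hLap]
  congr 1
  have h9 : ∀ g : Plane → ℂ, ∫ z, g z ∂(lamP • volume : Measure Plane) = (lamP : ℂ) * ∫ z, g z := by
    intro g
    rw [integral_smul_nnreal_measure]
    rfl
  rw [h9, neg_mul]

end ClusterProcess

/-- Joint measurability in measure and radius: an open ball is the increasing union of the smaller
balls of rational radius, so a countable supremum suffices. -/
lemma measurable_measure_ball :
    Measurable fun q : Measure Plane × ℝ => q.1 (Metric.ball 0 q.2) := by
  have h : (fun q : Measure Plane × ℝ => q.1 (Metric.ball 0 q.2)) = fun q =>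
      ⨆ t : ℚ, {q : Measure Plane × ℝ | (t : ℝ) < q.2}.indicator
        (fun q => q.1 (Metric.ball 0 t)) q := by
    ext q
    refine le_antisymm ?_ (iSup_le fun t => ?_)
    · have hU : Metric.ball (0 : Plane) q.2 = ⋃ t : {t : ℚ // (t : ℝ) < q.2},
          Metric.ball (0 : Plane) (t : ℚ) := by
        ext x
        simp only [mem_ball_zero_iff, mem_iUnion, Subtype.exists, exists_prop]
        constructor
        · intro hx
          obtain ⟨t, h1, h2⟩ := exists_rat_btwn hx
          exact ⟨t, h2, h1⟩
        · rintro ⟨t, h1, h2⟩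
          exact h2.trans h1
      have hmono : Monotone fun t : {t : ℚ // (t : ℝ) < q.2} =>
          Metric.ball (0 : Plane) (t : ℚ) := fun s t hst =>
        Metric.ball_subset_ball (by exact_mod_cast hst)
      rw [hU, hmono.directed_le.measure_iUnion]
      refine iSup_le fun t => ?_
      refine le_iSup_of_le (t : ℚ) ?_
      rw [indicator_of_mem (show q ∈ {q : Measure Plane × ℝ | ((t : ℚ) : ℝ) < q.2} from t.2)]
    · by_cases ht : (t : ℝ) < q.2
      · rw [indicator_of_mem (show q ∈ {q : Measure Plane × ℝ | (t : ℝ) < q.2} from ht)]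
        exact measure_mono (Metric.ball_subset_ball ht.le)
      · rw [indicator_of_notMem (show q ∉ {q : Measure Plane × ℝ | (t : ℝ) < q.2} from ht)]
        exact zero_le
  rw [h]
  refine Measurable.iSup fun t => Measurable.indicator ?_ ?_
  · exact (Measure.measurable_coe Metric.isOpen_ball.measurableSet).comp measurable_fst
  · exact measurableSet_lt measurable_const measurable_snd

lemma measurable_equivRadius : Measurable equivRadius :=
  (measurable_id.div_const _).sqrt

/-! ### Density of the equal-area radius -/

section NakagamiDensity

variable {lamB : ℝ≥0}

lemma integrable_equivRadiusPDF (hB : 0 < lamB) : Integrable (equivRadiusPDF lamB) := by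
  have h1 : Integrable nakagamiPDF := by
    have h := (integrable_rpow_mul_exp_neg_mul_sq (b := 3.5) (by norm_num) (s := 6)
      (by norm_num)).const_mul (2 * (3.5 : ℝ) ^ (3.5 : ℝ) / Real.Gamma 3.5)
    refine h.congr (ae_of_all _ fun x => ?_)
    have : x ^ (6 : ℝ) = x ^ 6 := by exact_mod_cast Real.rpow_natCast x 6
    simp only [nakagamiPDF, this]
    ring_nf
  have hb : √(Real.pi * lamB) ≠ 0 := (Real.sqrt_pos.mpr (by positivity)).ne'
  exact (h1.comp_mul_left' hb).const_mul _

/-- Substitution x = π lamB r² with its Jacobian. The shape exponent 3.5 - 1 produces a fifth power,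
and the Jacobian supplies the sixth. -/
lemma gammaPDFReal_mul_sq_eq_equivRadiusPDF {r : ℝ} (hr : 0 < r) (hB : 0 < lamB) :
    2 * r * (Real.pi * lamB) * gammaPDFReal 3.5 3.5 (Real.pi * lamB * r ^ 2) =
      equivRadiusPDF lamB r := by
  have hb : 0 < Real.pi * (lamB : ℝ) := by positivity
  rw [gammaPDFReal, if_pos (by positivity), equivRadiusPDF, nakagamiPDF]
  set y := √(Real.pi * lamB) with hy
  have hy0 : 0 < y := Real.sqrt_pos.mpr hb
  have hy2 : Real.pi * (lamB : ℝ) = y ^ 2 := (Real.sq_sqrt hb.le).symm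
  rw [hy2]
  have h1 : (y ^ 2 * r ^ 2) ^ ((3.5 : ℝ) - 1) = (y * r) ^ 5 := by
    rw [← mul_pow, ← Real.rpow_natCast, ← Real.rpow_mul (by positivity), ← Real.rpow_natCast]
    norm_num
  rw [h1]
  ring_nf

/-- If `lamB * A` is Gamma distributed with shape and rate `3.5`, then the radius of the disc of
area `A` has density `equivRadiusPDF lamB`. -/
lemma integral_comp_equivRadius {Ω : Type*} [MeasurableSpace Ω] {μ : Measure Ω} {A : Ω → ℝ}
    (hB : 0 < lamB) (hA : HasLaw (fun ω => (lamB : ℝ) * A ω) (gammaMeasure 3.5 3.5) μ)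
    {g : ℝ → ℂ} (hg : Measurable g) :
    ∫ ω, g (equivRadius (A ω)) ∂μ = ∫ r in Ioi (0 : ℝ), g r * equivRadiusPDF lamB r := by
  have hlam : (lamB : ℝ) ≠ 0 := by positivity
  have hmeas : Measurable fun x : ℝ => g (equivRadius (x / lamB)) :=
    hg.comp (measurable_equivRadius.comp (measurable_id.div_const _))
  have h1 := hA.integral_comp (f := fun x => g (equivRadius (x / lamB)))
    hmeas.aestronglyMeasurable
  simp only [Function.comp_def, mul_div_cancel_left₀ _ hlam] at h1
  have h2 : ∫ x, g (equivRadius (x / lamB)) ∂(gammaMeasure 3.5 3.5) =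
      ∫ x in Ioi (0 : ℝ), gammaPDFReal 3.5 3.5 x • g (equivRadius (x / lamB)) := by
    rw [gammaMeasure, show gammaPDF 3.5 3.5 = fun x => ENNReal.ofReal (gammaPDFReal 3.5 3.5 x)
      from rfl, integral_withDensity_eq_integral_toReal_smul
      (measurable_gammaPDFReal 3.5 3.5).ennreal_ofReal (ae_of_all _ fun _ => ENNReal.ofReal_lt_top),
      ← integral_Ici_eq_integral_Ioi, ← integral_indicator measurableSet_Ici]
    refine integral_congr_ae (ae_of_all _ fun x => ?_)
    by_cases hx : 0 ≤ x
    · rw [indicator_of_mem (mem_Ici.mpr hx)]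
      dsimp only
      rw [ENNReal.toReal_ofReal (gammaPDFReal_nonneg (by norm_num) (by norm_num) x)]
    · rw [indicator_of_notMem (by simpa using hx)]
      simp only [gammaPDFReal, if_neg hx]
      simp
  have hb : 0 < Real.pi * (lamB : ℝ) := by positivity
  -- The substitution is made in two stages: scaling by π lamB, then squaring.
  have h3 := integral_comp_mul_left_Ioi
    (fun x => gammaPDFReal 3.5 3.5 x • g (equivRadius (x / lamB))) 0 hb
  rw [mul_zero] at h3
  have h4 := integral_comp_rpow_Ioi_of_pos (g := fun x : ℝ =>
    gammaPDFReal 3.5 3.5 (Real.pi * lamB * x) • g (equivRadius (Real.pi * lamB * x / lamB)))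
    (p := 2) two_pos
  rw [h1, h2, ← smul_inv_smul₀ hb.ne' (∫ x in Ioi (0 : ℝ),
    gammaPDFReal 3.5 3.5 x • g (equivRadius (x / lamB))), ← h3, ← h4, ← integral_smul]
  refine setIntegral_congr_fun measurableSet_Ioi fun r hr => ?_
  have hr' : (0 : ℝ) < r := hr
  have h5 : r ^ (2 : ℝ) = r ^ 2 := by exact_mod_cast Real.rpow_natCast r 2
  have h6 : r ^ ((2 : ℝ) - 1) = r := by norm_num
  have h7 : equivRadius (Real.pi * lamB * r ^ 2 / lamB) = r := by
    rw [equivRadius, show Real.pi * lamB * r ^ 2 / lamB / Real.pi = r ^ 2 by field_simp,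
      Real.sqrt_sq hr'.le]
  simp only [h5, h6, h7]
  rw [← gammaPDFReal_mul_sq_eq_equivRadiusPDF hr' hB]
  simp only [Complex.real_smul]
  push_cast
  ring

end NakagamiDensity

/-! ### Load of the disc of random radius -/

section DiscLoad

variable {Ω : Type*} [MeasurableSpace Ω] {μ : Measure Ω} [IsProbabilityMeasure μ]
  {Φ : Ω → Measure Plane} {lamP mbar lamB : ℝ≥0} {f : Plane → ℝ} {A : Ω → ℝ}

/-- The radius is random, so one null set must serve all radii: balls of integer radius are
countably many and contain all the others. -/
lemma IsPoissonClusterProcess.ae_discLoad_eq (hΦ : IsPoissonClusterProcess Φ lamP mbar f μ)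
    (A : Ω → ℝ) :
    ∀ᵐ ω ∂μ, (discLoad Φ A ω : ℝ≥0∞) = Φ ω (Metric.ball 0 (equivRadius (A ω))) := by
  have h : ∀ n : ℕ, ∀ᵐ ω ∂μ, Φ ω (Metric.ball 0 (n : ℝ)) ≠ ∞ := fun n =>
    hΦ.ae_count_ne_top Metric.isOpen_ball.measurableSet measure_ball_lt_top.ne
  filter_upwards [ae_all_iff.mpr h] with ω hω
  obtain ⟨n, hn⟩ := exists_nat_ge (equivRadius (A ω))
  have hfin : Φ ω (Metric.ball 0 (equivRadius (A ω))) ≠ ∞ :=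
    ne_top_of_le_ne_top (hω n) (measure_mono (Metric.ball_subset_ball hn))
  obtain ⟨k, hk⟩ := hΦ.exists_natCast Metric.isOpen_ball.measurableSet hfin
  rw [discLoad, hk, ENNReal.toReal_natCast, Nat.floor_natCast]

lemma hitProb_ball {ν : Measure Plane} (r : ℝ) (z : Plane) :
    hitProb ν (Metric.ball 0 r) z = ν {s | ‖z + s‖ < r} := by
  simp only [hitProb, mem_ball_zero_iff]

variable {p : ℝ → ℝ → ℝ}

lemma integrable_one_sub_exp_hitProb {ν : Measure Plane} [IsProbabilityMeasure ν] {B : Set Plane}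
    (hB : MeasurableSet B) (hvol : volume B ≠ ∞) {c : ℂ} (hc : 0 ≤ c.re) :
    Integrable fun z => 1 - Complex.exp (-c * (hitProb ν B z).toReal) := by
  have hm : Measurable fun z => (hitProb ν B z).toReal := (measurable_hitProb hB).ennreal_toReal
  have hi : Integrable fun z => (hitProb ν B z).toReal :=
    integrable_toReal_of_lintegral_ne_top (measurable_hitProb hB).aemeasurable
      (by rwa [lintegral_hitProb hB])
  refine (hi.const_mul ‖c‖).mono' (Measurable.aestronglyMeasurable (by fun_prop))
    (ae_of_all _ fun z => norm_one_sub_exp_neg_mul_ofReal_le hc ENNReal.toReal_nonneg)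

lemma integrableOn_clusterIntegrand {ν : Measure Plane} [IsProbabilityMeasure ν] {r : ℝ}
    (hp : ∀ z : Plane, ν.real {s | ‖z + s‖ < r} = p r ‖z‖) {θ : ℂ} (hθ : ‖θ‖ ≤ 1) :
    IntegrableOn (clusterIntegrand mbar (fun v => p r v) θ) (Ioi 0) := by
  have h := integrable_one_sub_exp_hitProb (ν := ν) (B := Metric.ball 0 r)
    Metric.isOpen_ball.measurableSet measure_ball_lt_top.ne (re_mul_one_sub_nonneg mbar hθ)
  simp_rw [hitProb_ball, ← Measure.real_def, hp] at h
  have h2 := (integrable_fun_norm_addHaar (volume : Measure Plane) (f := fun v : ℝ =>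
    1 - Complex.exp (-(((mbar : ℝ) : ℂ) * (1 - θ)) * p r v))).mp h
  refine h2.congr_fun (fun v _ => ?_) measurableSet_Ioi
  simp only [clusterIntegrand, finrank_euclideanSpace, Fintype.card_fin, Complex.real_smul]
  push_cast
  ring_nf

/-- Polar coordinates in dimension 2: the constant is the dimension times the area π of the unit
disc, and the Jacobian is v. -/
lemma integral_clusterIntegrand {ν : Measure Plane} {r : ℝ}
    (hp : ∀ z : Plane, ν.real {s | ‖z + s‖ < r} = p r ‖z‖) {θ : ℂ} :
    ∫ z, (1 - Complex.exp (-((mbar : ℂ) * (1 - θ)) *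
        (hitProb ν (Metric.ball 0 r) z).toReal)) =
      2 * Real.pi * ∫ v in Ioi (0 : ℝ), clusterIntegrand mbar (p r) θ v := by
  simp_rw [hitProb_ball, ← Measure.real_def, hp]
  have h2 := integral_fun_norm_addHaar (volume : Measure Plane) (fun v : ℝ =>
    1 - Complex.exp (-((mbar : ℂ) * (1 - θ)) * p r v))
  rw [h2]
  have hvol : (volume : Measure Plane).real (Metric.ball 0 1) = Real.pi := by
    rw [Measure.real, EuclideanSpace.volume_ball_fin_two]
    simp [Real.pi_nonneg]
  have h3 : ∀ v : ℝ, v ^ (Module.finrank ℝ Plane - 1) •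
      (1 - Complex.exp (-((mbar : ℂ) * (1 - θ)) * p r v)) = clusterIntegrand mbar (p r) θ v := by
    intro v
    simp only [clusterIntegrand, finrank_euclideanSpace, Fintype.card_fin, Complex.real_smul]
    push_cast
    ring_nf
  simp_rw [h3]
  rw [hvol, finrank_euclideanSpace, Fintype.card_fin, Complex.real_smul, nsmul_eq_mul]
  push_cast
  ring

/-- The load distribution of a disc with random Nakagami radius, for a Poisson cluster process with
isotropic hitting probabilities. -/
theorem IsPoissonClusterProcess.discLoad_pgf (hΦ : IsPoissonClusterProcess Φ lamP mbar f μ)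
    (hB : 0 < lamB) (hA : HasLaw (fun ω => (lamB : ℝ) * A ω) (gammaMeasure 3.5 3.5) μ)
    (hind : IndepFun Φ A μ)
    (hp : ∀ (z : Plane) (r : ℝ), 0 ≤ r →
      (volume.withDensity fun s => ENNReal.ofReal (f s)).real {s | ‖z + s‖ < r} = p r ‖z‖)
    {θ : ℂ} (hθ : ‖θ‖ ≤ 1) :
    Integrable (fun ω => θ ^ discLoad Φ A ω) μ ∧
    (∀ r : ℝ, 0 < r → IntegrableOn (clusterIntegrand mbar (fun v => p r v) θ) (Ioi 0)) ∧
    IntegrableOn (loadPGFIntegrand lamB lamP mbar (fun r v => p r v) θ) (Ioi 0) ∧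
    ∫ ω, θ ^ discLoad Φ A ω ∂μ =
      ∫ r in Ioi (0 : ℝ), loadPGFIntegrand lamB lamP mbar (fun r v => p r v) θ r := by
  have hprob := hΦ.isProbabilityMeasure
  have hAm : AEMeasurable A μ := by
    have h := hA.aemeasurable.const_mul (lamB : ℝ)⁻¹
    have hlam : (lamB : ℝ) ≠ 0 := by positivity
    simpa only [inv_mul_cancel_left₀ hlam] using h
  have hpow : Measurable fun q : Measure Plane × ℝ =>
      θ ^ ⌊(q.1 (Metric.ball 0 q.2)).toReal⌋₊ :=
    (Measurable.of_discrete (f := fun k : ℕ => θ ^ k)).comp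
      (Nat.measurable_floor.comp measurable_measure_ball.ennreal_toReal)
  have hpow1 : ∀ k : ℕ, ‖θ ^ k‖ ≤ 1 := fun k => by
    rw [norm_pow]
    exact pow_le_one₀ (norm_nonneg _) hθ
  -- `g r` is the conditional generating function given that the radius equals `r`.
  obtain ⟨g, hgdef⟩ : ∃ g : ℝ → ℂ,
      g = fun r => ∫ ω, θ ^ ⌊(Φ ω (Metric.ball 0 r)).toReal⌋₊ ∂μ := ⟨_, rfl⟩
  have hgF : Measurable fun q : ℝ × Ω => θ ^ ⌊(Φ q.2 (Metric.ball 0 q.1)).toReal⌋₊ := by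
    have h : Measurable fun q : ℝ × Ω => (Φ q.2, q.1) :=
      (hΦ.measurable.comp measurable_snd).prodMk measurable_fst
    simpa only [Function.comp_def] using hpow.comp h
  have hg : Measurable g := hgdef ▸ hgF.stronglyMeasurable.integral_prod_right'.measurable
  have hg1 : ∀ r, ‖g r‖ ≤ 1 := by
    intro r
    rw [hgdef]
    refine (norm_integral_le_of_norm_le_const (C := 1) (ae_of_all _ fun ω => hpow1 _)).trans ?_
    simp
  have hgr : ∀ r ∈ Ioi (0 : ℝ), g r * equivRadiusPDF lamB r =
      loadPGFIntegrand lamB lamP mbar (fun r v => p r v) θ r := by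
    intro r hr
    have h1 := hΦ.integral_pow_count (B := Metric.ball 0 r) Metric.isOpen_ball.measurableSet
      measure_ball_lt_top.ne hθ
    rw [integral_clusterIntegrand fun z => hp z r (le_of_lt hr)] at h1
    simp only [loadPGFIntegrand, hgdef]
    rw [h1]
    congr 2
    ring
  refine ⟨?_, fun r hr => integrableOn_clusterIntegrand (fun z => hp z r hr.le) hθ, ?_, ?_⟩
  · refine Integrable.of_bound (C := 1) ?_ (ae_of_all _ fun ω => hpow1 _)
    exact (hpow.comp_aemeasurable (hΦ.measurable.aemeasurable.prodMk
      (measurable_equivRadius.comp_aemeasurable hAm))).aestronglyMeasurable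
  · refine IntegrableOn.congr_fun ?_ hgr measurableSet_Ioi
    exact ((integrable_equivRadiusPDF hB).ofReal.bdd_mul hg.aestronglyMeasurable
      (ae_of_all _ hg1)).integrableOn
  · rw [← setIntegral_congr_fun measurableSet_Ioi hgr, ← integral_comp_equivRadius hB hA hg,
      hgdef]
    have hswap : Measurable fun q : ℝ × Measure Plane => (q.2, equivRadius q.1) :=
      measurable_snd.prodMk (measurable_equivRadius.comp measurable_fst)
    have hF := hpow.comp hswap
    simp only [Function.comp_def] at hF
    exact hind.symm.integral_eq_integral_integral hAm hΦ.measurable.aemeasurable hF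
      fun q => hpow1 _

end DiscLoad

/-! ### Integral representation of I₀ -/

section Bessel

lemma integral_cos_pow_two_mul (k : ℕ) :
    ∫ x in (-Real.pi)..Real.pi, Real.cos x ^ (2 * k) =
      2 * Real.pi * ((2 * k).factorial / (4 ^ k * (k.factorial : ℝ) ^ 2)) := by
  induction k with
  | zero => simp; ring
  | succ k ih =>
    rw [show 2 * (k + 1) = 2 * k + 2 by ring, integral_cos_pow, ih]
    simp only [Real.sin_pi, Real.sin_neg, neg_zero, mul_zero, sub_self, zero_div, zero_add,
      Nat.factorial_succ]
    push_cast
    have : (k.factorial : ℝ) ≠ 0 := by positivity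
    field_simp
    ring

lemma integral_cos_pow_two_mul_add_one (k : ℕ) :
    ∫ x in (-Real.pi)..Real.pi, Real.cos x ^ (2 * k + 1) = 0 := by
  induction k with
  | zero => simp
  | succ k ih =>
    rw [show 2 * (k + 1) + 1 = (2 * k + 1) + 2 by ring, integral_cos_pow, ih]
    simp

/-- Expand the exponential and integrate termwise: odd cosine moments vanish, and the even ones turn
1/(2k)! into the Bessel coefficients. -/
lemma integral_exp_mul_cos (x : ℝ) :
    ∫ φ in (-Real.pi)..Real.pi, Real.exp (x * Real.cos φ) = 2 * Real.pi * besselI0 x := by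
  have hsum : HasSum (fun n : ℕ => ∫ φ in (-Real.pi)..Real.pi,
      (x * Real.cos φ) ^ n / n.factorial)
      (∫ φ in (-Real.pi)..Real.pi, Real.exp (x * Real.cos φ)) := by
    refine intervalIntegral.hasSum_integral_of_dominated_convergence
      (fun n _ => |x| ^ n / n.factorial) (fun n => ?_) (fun n => ?_) ?_ ?_ ?_
    · exact Continuous.aestronglyMeasurable (by fun_prop)
    · refine ae_of_all _ fun φ _ => ?_
      rw [norm_div, norm_pow, Real.norm_natCast, Real.norm_eq_abs, abs_mul]
      gcongr
      exact mul_le_of_le_one_right (abs_nonneg x) (Real.abs_cos_le_one φ)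
    · exact ae_of_all _ fun φ _ => Real.summable_pow_div_factorial |x|
    · exact intervalIntegrable_const
    · refine ae_of_all _ fun φ _ => ?_
      rw [Real.exp_eq_exp_ℝ]
      exact NormedSpace.expSeries_div_hasSum_exp (x * Real.cos φ)
  have hterm : ∀ n : ℕ, ∫ φ in (-Real.pi)..Real.pi, (x * Real.cos φ) ^ n / n.factorial =
      x ^ n / n.factorial * ∫ φ in (-Real.pi)..Real.pi, Real.cos φ ^ n := by
    intro n
    rw [← intervalIntegral.integral_const_mul]
    congr 1
    ext φ
    rw [mul_pow]
    ring
  simp_rw [hterm] at hsum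
  have hodd : ∀ n ∉ range fun k : ℕ => 2 * k,
      x ^ n / n.factorial * ∫ φ in (-Real.pi)..Real.pi, Real.cos φ ^ n = 0 := by
    intro n hn
    obtain ⟨k, hk | hk⟩ := Nat.even_or_odd' n
    · exact absurd ⟨k, hk.symm⟩ hn
    · rw [hk, integral_cos_pow_two_mul_add_one, mul_zero]
  have hinj : Function.Injective fun k : ℕ => 2 * k := fun a b h => by
    simpa using h
  have h2 := (hinj.hasSum_iff hodd).mpr hsum
  rw [← h2.tsum_eq, besselI0, ← tsum_mul_left]
  congr 1
  ext k
  simp only [Function.comp_apply]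
  rw [integral_cos_pow_two_mul, div_pow, pow_mul 2 2 k]
  have h3 : ((2 * k).factorial : ℝ) ≠ 0 := by positivity
  field_simp
  norm_num

lemma besselI0_eq_integral (x : ℝ) :
    besselI0 x = (2 * Real.pi)⁻¹ * ∫ φ in (-Real.pi)..Real.pi, Real.exp (x * Real.cos φ) := by
  rw [integral_exp_mul_cos, inv_mul_cancel_left₀ (by positivity)]

lemma besselI0_nonneg (x : ℝ) : 0 ≤ besselI0 x :=
  tsum_nonneg fun k => div_nonneg (by rw [pow_mul]; positivity) (by positivity)

/-- Measurability is read off the integral representation, a parametric integral of a jointly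
measurable function. -/
lemma measurable_besselI0 : Measurable besselI0 := by
  have h : StronglyMeasurable fun x : ℝ => ∫ φ in Ioc (-Real.pi) Real.pi,
      Real.exp (x * Real.cos φ) :=
    StronglyMeasurable.integral_prod_right' (f := fun q : ℝ × ℝ => Real.exp (q.1 * Real.cos q.2))
      (Measurable.stronglyMeasurable (by fun_prop))
  have h2 : besselI0 = fun x => (2 * Real.pi)⁻¹ * ∫ φ in Ioc (-Real.pi) Real.pi,
      Real.exp (x * Real.cos φ) := by
    ext x
    rw [besselI0_eq_integral, intervalIntegral.integral_of_le (by linarith [Real.pi_pos])]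
  rw [h2]
  exact h.measurable.const_mul _

end Bessel

/-! ### Radial densities in polar coordinates about another centre -/

section Polar

/-- Any isometry ℂ → `Plane` sends ‖z‖ to a vector as long as `z`; a reflection exchanges the two.
This lets `z` be placed on the positive real axis. -/
lemma exists_linearIsometryEquiv_complex (z : Plane) :
    ∃ U : ℂ ≃ₗᵢ[ℝ] Plane, U (‖z‖ : ℂ) = z := by
  let U₀ : ℂ ≃ₗᵢ[ℝ] Plane := Complex.orthonormalBasisOneI.repr
  have h : ‖U₀ (‖z‖ : ℂ)‖ = ‖z‖ := by simp
  exact ⟨U₀.trans (ℝ ∙ (U₀ (‖z‖ : ℂ) - z))ᗮ.reflection, Submodule.reflection_sub h⟩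

/-- After rotating `z` to the real axis, the second distance is given by the law of cosines. -/
lemma lintegral_norm_norm_sub (z : Plane) {H : ℝ → ℝ → ℝ≥0∞} (hH : Measurable (Function.uncurry H)) :
    ∫⁻ x : Plane, H ‖x‖ ‖x - z‖ = ∫⁻ ρ in Ioi (0 : ℝ), ENNReal.ofReal ρ *
      ∫⁻ φ in Ioo (-Real.pi) Real.pi, H ρ √(ρ ^ 2 - 2 * ρ * ‖z‖ * Real.cos φ + ‖z‖ ^ 2) := by
  obtain ⟨U, hU⟩ := exists_linearIsometryEquiv_complex z
  have h1 : ∫⁻ x : Plane, H ‖x‖ ‖x - z‖ = ∫⁻ w : ℂ, H ‖w‖ ‖w - ‖z‖‖ := by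
    rw [← U.measurePreserving.lintegral_comp_emb U.toHomeomorph.measurableEmbedding]
    refine lintegral_congr fun w => ?_
    rw [U.norm_map]
    congr 1
    conv_lhs => rw [← hU, ← map_sub, U.norm_map]
  have hn : ∀ ρ φ : ℝ, ‖(ρ * (Real.cos φ + Real.sin φ * Complex.I) - ‖z‖ : ℂ)‖ =
      √(ρ ^ 2 - 2 * ρ * ‖z‖ * Real.cos φ + ‖z‖ ^ 2) := by
    intro ρ φ
    rw [Complex.norm_def, Complex.normSq_apply]
    congr 1
    simp only [Complex.sub_re, Complex.sub_im, Complex.mul_re, Complex.mul_im, Complex.add_re,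
      Complex.add_im, Complex.ofReal_re, Complex.ofReal_im, Complex.I_re, Complex.I_im]
    linear_combination ρ ^ 2 * Real.sin_sq_add_cos_sq φ
  rw [h1, ← Complex.lintegral_comp_polarCoord_symm, polarCoord_target, Measure.volume_eq_prod,
    ← Measure.prod_restrict, lintegral_prod]
  · refine setLIntegral_congr_fun measurableSet_Ioi fun ρ hρ => ?_
    dsimp only
    rw [← lintegral_const_mul']
    · refine lintegral_congr fun φ => ?_
      rw [Complex.norm_polarCoord_symm, Complex.polarCoord_symm_apply, smul_eq_mul]
      simp only
      rw [hn, abs_of_pos hρ]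
    · exact ENNReal.ofReal_ne_top
  · refine Measurable.aemeasurable ?_
    simp only [Complex.norm_polarCoord_symm, smul_eq_mul]
    simp only [Complex.polarCoord_symm_apply, hn]
    have : Measurable fun q : ℝ × ℝ =>
        (|q.1|, √(q.1 ^ 2 - 2 * q.1 * ‖z‖ * Real.cos q.2 + ‖z‖ ^ 2)) := by fun_prop
    exact (ENNReal.measurable_ofReal.comp measurable_fst).mul (hH.comp this)

/-- Mass of a rotation invariant density on the translate of a rotation invariant set, in polar
coordinates. -/
lemma withDensity_norm_add_mem (z : Plane) {f₀ : ℝ → ℝ} (hf₀ : Measurable f₀) {T : Set ℝ}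
    (hT : MeasurableSet T) :
    (volume.withDensity fun s : Plane => ENNReal.ofReal (f₀ ‖s‖)) {s | ‖z + s‖ ∈ T} =
      ∫⁻ ρ in Ioi (0 : ℝ) ∩ T, ENNReal.ofReal ρ * ∫⁻ φ in Ioo (-Real.pi) Real.pi,
        ENNReal.ofReal (f₀ √(ρ ^ 2 - 2 * ρ * ‖z‖ * Real.cos φ + ‖z‖ ^ 2)) := by
  have hT' : MeasurableSet {s : Plane | ‖z + s‖ ∈ T} :=
    (measurable_norm.comp (measurable_const_add z)) hT
  let H : ℝ → ℝ → ℝ≥0∞ := fun ρ t => T.indicator 1 ρ * ENNReal.ofReal (f₀ t)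
  have hH : Measurable (Function.uncurry H) :=
    ((measurable_one.indicator hT).comp measurable_fst).mul
      (ENNReal.measurable_ofReal.comp (hf₀.comp measurable_snd))
  have h1 : ∫⁻ x : Plane, H ‖x‖ ‖x - z‖ = ∫⁻ s : Plane, {s : Plane | ‖z + s‖ ∈ T}.indicator
      (fun s => ENNReal.ofReal (f₀ ‖s‖)) s := by
    rw [← lintegral_add_left_eq_self _ z]
    refine lintegral_congr fun s => ?_
    by_cases h : ‖z + s‖ ∈ T <;> simp [H, h, indicator]
  rw [withDensity_apply _ hT', ← lintegral_indicator hT', ← h1, lintegral_norm_norm_sub z hH,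
    inter_comm, ← Measure.restrict_restrict hT, ← lintegral_indicator hT]
  refine lintegral_congr fun ρ => ?_
  by_cases h : ρ ∈ T <;> simp [H, h]

end Polar

/-! ### Hitting probability for Gaussian displacements -/

section Thomas

variable {σ : ℝ}

lemma isProbabilityMeasure_thomasPDF (hσ : 0 < σ) :
    IsProbabilityMeasure (volume.withDensity fun s => ENNReal.ofReal (thomasPDF σ s)) := by
  have hb : 0 < 1 / (2 * σ ^ 2) := by positivity
  have h1 : ∫ s : Plane, Real.exp (-(1 / (2 * σ ^ 2)) * ‖s‖ ^ 2) = 2 * Real.pi * σ ^ 2 := by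
    rw [GaussianFourier.integral_rexp_neg_mul_sq_norm hb, finrank_euclideanSpace, Fintype.card_fin,
      Nat.cast_ofNat, div_self two_ne_zero, Real.rpow_one]
    field_simp
  -- A non-integrable function has integral `0` by convention, so the positive value in `h1` proves
  -- integrability.
  have h2 : Integrable fun s : Plane => Real.exp (-(1 / (2 * σ ^ 2)) * ‖s‖ ^ 2) :=
    not_not.mp fun h => by
      rw [integral_undef h] at h1
      have : 0 < 2 * Real.pi * σ ^ 2 := by positivity
      linarith
  have h3 : thomasPDF σ = fun s => 1 / (2 * Real.pi * σ ^ 2) *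
      Real.exp (-(1 / (2 * σ ^ 2)) * ‖s‖ ^ 2) := by
    ext s
    rw [thomasPDF]
    ring_nf
  constructor
  rw [withDensity_apply _ MeasurableSet.univ, Measure.restrict_univ,
    ← ofReal_integral_eq_lintegral_ofReal, h3, integral_const_mul, h1,
    one_div_mul_cancel (by positivity), ENNReal.ofReal_one]
  · rw [h3]
    exact h2.const_mul _
  · exact ae_of_all _ fun s => by unfold thomasPDF; positivity

/-- The probability that a planar Gaussian vector centred at a point lands in a disc centred at the
origin. -/
lemma thomasPDF_real_norm_add_lt (hσ : 0 < σ) (z : Plane) {r : ℝ} (hr : 0 ≤ r) :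
    (volume.withDensity fun s => ENNReal.ofReal (thomasPDF σ s)).real {s | ‖z + s‖ < r} =
      1 - marcumQ1 (‖z‖ / σ) (r / σ) := by
  have hprob := isProbabilityMeasure_thomasPDF hσ
  set ν := volume.withDensity fun s => ENNReal.ofReal (thomasPDF σ s) with hν
  set α := ‖z‖ / σ with hα
  let K : ℝ → ℝ := fun y => y * Real.exp (-(y ^ 2 + α ^ 2) / 2) * besselI0 (α * y)
  have hKm : Measurable K := by
    have : Measurable fun y => besselI0 (α * y) :=
      measurable_besselI0.comp (measurable_const_mul α)
    exact Measurable.mul (by fun_prop) this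
  have hK0 : ∀ y, 0 ≤ y → 0 ≤ K y := fun y hy =>
    mul_nonneg (by positivity) (besselI0_nonneg _)
  have hS : MeasurableSet {s : Plane | ‖z + s‖ < r} :=
    measurableSet_lt (by fun_prop) measurable_const
  have hcompl : {s : Plane | ‖z + s‖ < r}ᶜ = {s | ‖z + s‖ ∈ Ici r} := by
    ext s
    simp [not_lt]
  have hdens : thomasPDF σ = fun s => (fun t : ℝ => 1 / (2 * Real.pi * σ ^ 2) *
      Real.exp (-t ^ 2 / (2 * σ ^ 2))) ‖s‖ := rfl
  have hinner : ∀ ρ ∈ Ioi (0 : ℝ), ENNReal.ofReal ρ * ∫⁻ φ in Ioo (-Real.pi) Real.pi,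
      ENNReal.ofReal (1 / (2 * Real.pi * σ ^ 2) * Real.exp (-√(ρ ^ 2 - 2 * ρ * ‖z‖ * Real.cos φ +
        ‖z‖ ^ 2) ^ 2 / (2 * σ ^ 2))) = ENNReal.ofReal (σ⁻¹ * K (σ⁻¹ * ρ)) := by
    intro ρ hρ
    have hρ' : 0 < ρ := hρ
    have h1 : ∀ φ : ℝ, 1 / (2 * Real.pi * σ ^ 2) * Real.exp (-√(ρ ^ 2 - 2 * ρ * ‖z‖ * Real.cos φ +
        ‖z‖ ^ 2) ^ 2 / (2 * σ ^ 2)) =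
        1 / (2 * Real.pi * σ ^ 2) * Real.exp (-((σ⁻¹ * ρ) ^ 2 + α ^ 2) / 2) *
          Real.exp (α * (σ⁻¹ * ρ) * Real.cos φ) := by
      intro φ
      rw [Real.sq_sqrt, mul_assoc (1 / _) (Real.exp _), ← Real.exp_add, hα]
      · congr 2
        field_simp
        ring
      -- The radicand is (ρ - ‖z‖ cos φ)² + (‖z‖ sin φ)².
      · nlinarith [sq_nonneg (ρ - ‖z‖ * Real.cos φ), sq_nonneg (‖z‖ * Real.sin φ),
          Real.sin_sq_add_cos_sq φ]
    simp_rw [h1]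
    have hint : IntegrableOn (fun φ => 1 / (2 * Real.pi * σ ^ 2) *
        Real.exp (-((σ⁻¹ * ρ) ^ 2 + α ^ 2) / 2) * Real.exp (α * (σ⁻¹ * ρ) * Real.cos φ))
        (Ioo (-Real.pi) Real.pi) :=
      (Continuous.integrableOn_Icc (by fun_prop)).mono_set Ioo_subset_Icc_self
    rw [← ofReal_integral_eq_lintegral_ofReal hint (ae_of_all _ fun φ => by positivity),
      ← ENNReal.ofReal_mul hρ'.le, integral_const_mul, ← integral_Ioc_eq_integral_Ioo,
      ← intervalIntegral.integral_of_le (by linarith [Real.pi_pos]), integral_exp_mul_cos]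
    congr 1
    simp only [K]
    field_simp
  have hset : (Ioi (0 : ℝ) ∩ Ici r : Set ℝ) =ᵐ[volume] Ioi r := by
    have h : (Ioi (0 : ℝ) ∩ Ici r : Set ℝ) =ᵐ[volume] (Ioi (0 : ℝ) ∩ Ioi r : Set ℝ) :=
      (ae_eq_refl _).inter Ioi_ae_eq_Ici.symm
    rwa [Ioi_inter_Ioi, max_eq_right hr] at h
  -- The Marcum function is a tail integral, hence the complement is computed; y = ρ/σ gives its
  -- integrand.
  have hfar : ν {s | ‖z + s‖ < r}ᶜ = ∫⁻ ρ in Ioi r, ENNReal.ofReal (σ⁻¹ * K (σ⁻¹ * ρ)) := by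
    rw [hcompl, hν, hdens, withDensity_norm_add_mem z (by fun_prop) measurableSet_Ici,
      setLIntegral_congr_fun (measurableSet_Ioi.inter measurableSet_Ici) fun ρ hρ =>
        hinner ρ hρ.1, setLIntegral_congr hset]
  have hQ : marcumQ1 α (r / σ) = ν.real {s | ‖z + s‖ < r}ᶜ := by
    rw [Measure.real, hfar, ← integral_eq_lintegral_of_nonneg_ae, integral_const_mul,
      integral_comp_mul_left_Ioi K r (inv_pos.mpr hσ), inv_inv, smul_eq_mul,
      inv_mul_cancel_left₀ hσ.ne', inv_mul_eq_div]
    · rfl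
    · refine (ae_restrict_mem measurableSet_Ioi).mono fun ρ hρ => ?_
      have : 0 < ρ := hr.trans_lt hρ
      exact mul_nonneg (by positivity) (hK0 _ (by positivity))
    · exact ((hKm.comp (measurable_const_mul _)).const_mul _).aestronglyMeasurable
  rw [hQ, probReal_compl_eq_one_sub hS]
  ring

end Thomas

/-! ### Hitting probability for uniform displacements -/

section Matern

/-- Half the opening angle of the arc of the circle of radius `ρ` about the origin that lies in a
disc of radius `R` whose centre is at distance `v` from the origin. -/
noncomputable def halfArcAngle (R v ρ : ℝ) : ℝ :=
  -- At `v = 0` division by zero would make the arccosine π/2, whereas the circle lies wholly inside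
  -- or outside the disc.
  if v = 0 then if ρ ≤ R then Real.pi else 0
  else Real.arccos ((ρ ^ 2 + v ^ 2 - R ^ 2) / (2 * ρ * v))

lemma halfArcAngle_nonneg (R v ρ : ℝ) : 0 ≤ halfArcAngle R v ρ := by
  unfold halfArcAngle
  split_ifs
  · exact Real.pi_nonneg
  · exact le_rfl
  · exact Real.arccos_nonneg _

lemma halfArcAngle_le_pi (R v ρ : ℝ) : halfArcAngle R v ρ ≤ Real.pi := by
  unfold halfArcAngle
  split_ifs
  · exact le_rfl
  · exact Real.pi_nonneg
  · exact Real.arccos_le_pi _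

lemma measurable_halfArcAngle (R v : ℝ) : Measurable (halfArcAngle R v) := by
  unfold halfArcAngle
  split_ifs
  · exact Measurable.ite measurableSet_Iic measurable_const measurable_const
  · exact Real.measurable_arccos.comp (by fun_prop)

/-- The set lies between the open and closed intervals with endpoints ±arccos t. Clamping of
`Real.arccos` outside [-1, 1] gives the full and empty cases. -/
lemma volume_setOf_le_cos (t : ℝ) :
    volume (Ioo (-Real.pi) Real.pi ∩ {φ | t ≤ Real.cos φ}) =
      ENNReal.ofReal (2 * Real.arccos t) := by
  set a := Real.arccos t with ha
  have ha_pi : a ≤ Real.pi := Real.arccos_le_pi t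
  have hlow : Ioo (-a) a ⊆ Ioo (-Real.pi) Real.pi ∩ {φ | t ≤ Real.cos φ} := by
    intro φ hφ
    refine ⟨Ioo_subset_Ioo (by linarith) ha_pi hφ, ?_⟩
    have h1 : |φ| < a := abs_lt.mpr hφ
    have h2 : t < 1 := Real.arccos_pos.mp ((abs_nonneg φ).trans_lt h1)
    change t ≤ Real.cos φ
    rw [← Real.cos_abs]
    rcases le_total t (-1) with h3 | h3
    · exact h3.trans (Real.neg_one_le_cos _)
    · rw [← Real.cos_arccos h3 h2.le]
      exact Real.cos_le_cos_of_nonneg_of_le_pi (abs_nonneg φ) ha_pi h1.le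
  have hup : Ioo (-Real.pi) Real.pi ∩ {φ | t ≤ Real.cos φ} ⊆ Icc (-a) a := by
    rintro φ ⟨hφ, hc⟩
    have h1 : |φ| < Real.pi := abs_lt.mpr hφ
    change t ≤ Real.cos φ at hc
    rw [← Real.cos_abs] at hc
    rw [mem_Icc, ← abs_le, ha, ← Real.arccos_cos (abs_nonneg φ) h1.le]
    exact Real.antitone_arccos hc
  refine le_antisymm ((measure_mono hup).trans_eq ?_) (Eq.trans_le ?_ (measure_mono hlow))
  · rw [Real.volume_Icc]
    ring_nf
  · rw [Real.volume_Ioo]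
    ring_nf

lemma volume_setOf_sqrt_le {R v ρ : ℝ} (hR : 0 < R) (hv : 0 ≤ v) (hρ : 0 < ρ) :
    volume (Ioo (-Real.pi) Real.pi ∩
      {φ | √(ρ ^ 2 - 2 * ρ * v * Real.cos φ + v ^ 2) ≤ R}) =
      ENNReal.ofReal (2 * halfArcAngle R v ρ) := by
  by_cases hv0 : v = 0
  · subst hv0
    simp only [halfArcAngle, if_true, mul_zero, zero_mul, sub_zero, ne_eq, OfNat.ofNat_ne_zero,
      not_false_eq_true, zero_pow, add_zero, Real.sqrt_sq hρ.le]
    by_cases h : ρ ≤ R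
    · simp only [h, if_true, ofPred_true, inter_univ, Real.volume_Ioo]
      ring_nf
    · simp [h]
  · have hv' : 0 < v := lt_of_le_of_ne hv (Ne.symm hv0)
    rw [halfArcAngle, if_neg hv0, ← volume_setOf_le_cos]
    congr 2
    ext φ
    change √(ρ ^ 2 - 2 * ρ * v * Real.cos φ + v ^ 2) ≤ R ↔
      (ρ ^ 2 + v ^ 2 - R ^ 2) / (2 * ρ * v) ≤ Real.cos φ
    rw [Real.sqrt_le_left hR.le, div_le_iff₀ (by positivity)]
    constructor <;> intro h <;> linarith

/-- The whole circle lies in the disc: for v > 0 the quotient is at most -1 because (ρ + v)² ≤ R².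
-/
lemma halfArcAngle_of_le_sub {R v ρ : ℝ} (hv : 0 ≤ v) (hρ : 0 < ρ) (h : ρ ≤ R - v) :
    halfArcAngle R v ρ = Real.pi := by
  unfold halfArcAngle
  split_ifs with h1 h2
  · rfl
  · exact absurd (h.trans (by linarith)) h2
  · have hv' : 0 < v := lt_of_le_of_ne hv (Ne.symm h1)
    rw [Real.arccos_eq_pi, div_le_iff₀ (by positivity)]
    nlinarith

lemma halfArcAngle_of_le_sub' {R v ρ : ℝ} (hR : 0 < R) (hρ : 0 < ρ) (h : ρ ≤ v - R) :
    halfArcAngle R v ρ = 0 := by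
  have hv' : 0 < v := by linarith
  rw [halfArcAngle, if_neg hv'.ne', Real.arccos_eq_zero, le_div_iff₀ (by positivity)]
  nlinarith

/-- Strictness matters at `v = 0`, where ρ = R still gives the angle π. -/
lemma halfArcAngle_of_add_lt {R v ρ : ℝ} (hR : 0 < R) (hv : 0 ≤ v) (h : R + v < ρ) :
    halfArcAngle R v ρ = 0 := by
  unfold halfArcAngle
  split_ifs with h1 h2
  · linarith
  · rfl
  · have hv' : 0 < v := lt_of_le_of_ne hv (Ne.symm h1)
    have : 0 < ρ := by linarith
    rw [Real.arccos_eq_zero, le_div_iff₀ (by positivity)]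
    nlinarith

lemma intervalIntegrable_mul_halfArcAngle (R v a b : ℝ) :
    IntervalIntegrable (fun ρ => ρ * halfArcAngle R v ρ) volume a b := by
  have h : IntervalIntegrable (halfArcAngle R v) volume a b := by
    refine (intervalIntegrable_const (c := Real.pi)).mono_fun
      (measurable_halfArcAngle R v).aestronglyMeasurable (ae_of_all _ fun ρ => ?_)
    dsimp only
    rw [Real.norm_of_nonneg (halfArcAngle_nonneg R v ρ), Real.norm_of_nonneg Real.pi_nonneg]
    exact halfArcAngle_le_pi R v ρ
  exact h.continuousOn_mul continuousOn_id

/-- The radii |R - v| and R + v separate circles inside or disjoint from the disc, circles cut in an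
arc, and circles beyond it. -/
lemma integral_mul_halfArcAngle {R v r : ℝ} (hR : 0 < R) (hv : 0 ≤ v) (hr : 0 ≤ r) :
    ∫ ρ in (0 : ℝ)..r, ρ * halfArcAngle R v ρ = Real.pi / 2 * R ^ 2 * maternXi R r v := by
  set a := min r |R - v| with ha
  set b := min r (R + v) with hb
  have ha0 : 0 ≤ a := le_min hr (abs_nonneg _)
  have hab : a ≤ b := min_le_min_left r (abs_le.mpr ⟨by linarith, by linarith⟩)
  have hbr : b ≤ r := min_le_left _ _
  have hI := intervalIntegrable_mul_halfArcAngle R v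
  rw [← intervalIntegral.integral_add_adjacent_intervals (hI 0 a) (hI a r),
    ← intervalIntegral.integral_add_adjacent_intervals (hI a b) (hI b r)]
  have h1 : ∫ ρ in (0 : ℝ)..a, ρ * halfArcAngle R v ρ =
      Real.pi / 2 * (min r (max (R - v) 0)) ^ 2 := by
    rcases le_total v R with h | h
    · have hcongr : ∀ᵐ ρ ∂volume, ρ ∈ uIoc 0 a → ρ * halfArcAngle R v ρ = ρ * Real.pi := by
        refine ae_of_all _ fun ρ hρ => ?_
        rw [uIoc_of_le ha0] at hρ
        rw [halfArcAngle_of_le_sub hv hρ.1]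
        exact hρ.2.trans ((min_le_right _ _).trans_eq (abs_of_nonneg (by linarith)))
      rw [intervalIntegral.integral_congr_ae hcongr, intervalIntegral.integral_mul_const,
        integral_id, max_eq_left (by linarith), ha, abs_of_nonneg (by linarith)]
      ring
    · have hcongr : ∀ᵐ ρ ∂volume, ρ ∈ uIoc 0 a → ρ * halfArcAngle R v ρ = 0 := by
        refine ae_of_all _ fun ρ hρ => ?_
        rw [uIoc_of_le ha0] at hρ
        rw [halfArcAngle_of_le_sub' hR hρ.1, mul_zero]
        refine hρ.2.trans ((min_le_right _ _).trans_eq ?_)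
        rw [abs_of_nonpos (by linarith)]
        ring
      rw [intervalIntegral.integral_congr_ae hcongr, intervalIntegral.integral_zero,
        max_eq_right (by linarith), min_eq_right hr]
      ring
  -- At `v = 0` the two integrands differ, but the interval of integration collapses to a point.
  have h2 : ∫ ρ in a..b, ρ * halfArcAngle R v ρ =
      ∫ u in a..b, u * Real.arccos ((u ^ 2 + v ^ 2 - R ^ 2) / (2 * u * v)) := by
    by_cases hv0 : v = 0
    · subst hv0
      have : a = b := by rw [ha, hb, sub_zero, add_zero, abs_of_pos hR]
      rw [this, intervalIntegral.integral_same, intervalIntegral.integral_same]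
    · simp only [halfArcAngle, if_neg hv0]
  have h3 : ∫ ρ in b..r, ρ * halfArcAngle R v ρ = 0 := by
    refine intervalIntegral.integral_zero_ae (ae_of_all _ fun ρ hρ => ?_)
    rw [uIoc_of_le hbr] at hρ
    rw [halfArcAngle_of_add_lt hR hv, mul_zero]
    rcases min_lt_iff.mp hρ.1 with h | h
    · exact absurd hρ.2 (not_le.mpr h)
    · exact h
  rw [h1, h2, h3, maternXi, ← ha, ← hb]
  field_simp
  ring

/-- The probability that a uniform point of a disc lands in a disc centred at the origin. -/
lemma maternPDF_real_norm_add_lt {R : ℝ} (hR : 0 < R) (z : Plane) {r : ℝ} (hr : 0 ≤ r) :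
    (volume.withDensity fun s => ENNReal.ofReal (maternPDF R s)).real {s | ‖z + s‖ < r} =
      maternXi R r ‖z‖ := by
  classical
  let f₀ : ℝ → ℝ := fun t => if t ≤ R then 1 / (Real.pi * R ^ 2) else 0
  have hf₀ : Measurable f₀ := Measurable.ite measurableSet_Iic measurable_const measurable_const
  have hdens : maternPDF R = fun s => f₀ ‖s‖ := by
    ext s
    simp only [maternPDF, f₀]
  have hinner : ∀ ρ ∈ Ioi (0 : ℝ), ENNReal.ofReal ρ * ∫⁻ φ in Ioo (-Real.pi) Real.pi,
      ENNReal.ofReal (f₀ √(ρ ^ 2 - 2 * ρ * ‖z‖ * Real.cos φ + ‖z‖ ^ 2)) =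
      ENNReal.ofReal (2 / (Real.pi * R ^ 2) * (ρ * halfArcAngle R ‖z‖ ρ)) := by
    intro ρ hρ
    have hρ' : 0 < ρ := hρ
    -- The density is constant on the disc, so the angular integral is that constant times the arc's
    -- angular measure.
    set E := {φ | √(ρ ^ 2 - 2 * ρ * ‖z‖ * Real.cos φ + ‖z‖ ^ 2) ≤ R} with hE
    have hEm : MeasurableSet E := measurableSet_le (by fun_prop) measurable_const
    have h1 : ∀ φ, ENNReal.ofReal (f₀ √(ρ ^ 2 - 2 * ρ * ‖z‖ * Real.cos φ + ‖z‖ ^ 2)) =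
        E.indicator (fun _ => ENNReal.ofReal (1 / (Real.pi * R ^ 2))) φ := by
      intro φ
      by_cases h : √(ρ ^ 2 - 2 * ρ * ‖z‖ * Real.cos φ + ‖z‖ ^ 2) ≤ R
      · rw [indicator_of_mem (show φ ∈ E from h)]
        simp only [f₀, if_pos h]
      · rw [indicator_of_notMem (show φ ∉ E from h)]
        simp only [f₀, if_neg h, ENNReal.ofReal_zero]
    simp_rw [h1]
    rw [lintegral_indicator_const hEm, Measure.restrict_apply hEm, inter_comm,
      volume_setOf_sqrt_le hR (norm_nonneg z) hρ', ← ENNReal.ofReal_mul (by positivity),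
      ← ENNReal.ofReal_mul hρ'.le]
    congr 1
    ring
  have hset : {s : Plane | ‖z + s‖ < r} = {s | ‖z + s‖ ∈ Iio r} := rfl
  rw [hset, Measure.real, hdens, withDensity_norm_add_mem z hf₀ measurableSet_Iio,
    setLIntegral_congr_fun (measurableSet_Ioi.inter measurableSet_Iio) fun ρ hρ => hinner ρ hρ.1,
    Ioi_inter_Iio, ← integral_eq_lintegral_of_nonneg_ae, ← integral_Ioc_eq_integral_Ioo,
    ← intervalIntegral.integral_of_le hr, intervalIntegral.integral_const_mul,
    integral_mul_halfArcAngle hR (norm_nonneg z) hr]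
  · field_simp
  · refine (ae_restrict_mem measurableSet_Ioo).mono fun ρ hρ => ?_
    have := hρ.1
    have := halfArcAngle_nonneg R ‖z‖ ρ
    positivity
  · exact ((measurable_id.mul (measurable_halfArcAngle R ‖z‖)).const_mul _).aestronglyMeasurable

end Matern

/-! ### The Thomas and Matérn cases -/

theorem corollary1 {Ω : Type*} [MeasurableSpace Ω] (μ : Measure Ω) [IsProbabilityMeasure μ]
    (lamB lamP mbar : ℝ≥0) (hB : 0 < lamB) (hP : 0 < lamP)
    (Φ : Ω → Measure Plane) (A : Ω → ℝ)
    (hA : HasLaw (fun ω => (lamB : ℝ) * A ω) (gammaMeasure 3.5 3.5) μ)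
    (hind : IndepFun Φ A μ) :
    (∀ σ : ℝ, 0 < σ → IsThomasClusterProcess Φ lamP mbar σ μ →
      (∀ (z : Plane) (r : ℝ), 0 ≤ r →
        (volume.withDensity fun s => ENNReal.ofReal (thomasPDF σ s)).real {s | ‖z + s‖ < r} =
          1 - marcumQ1 (‖z‖ / σ) (r / σ)) ∧
      (∀ᵐ ω ∂μ, (discLoad Φ A ω : ℝ≥0∞) = Φ ω (Metric.ball 0 (equivRadius (A ω)))) ∧
      ∀ θ : ℂ, ‖θ‖ ≤ 1 →
        Integrable (fun ω => θ ^ discLoad Φ A ω) μ ∧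
        (∀ r : ℝ, 0 < r → IntegrableOn
          (clusterIntegrand mbar (fun v => 1 - marcumQ1 (v / σ) (r / σ)) θ) (Ioi 0)) ∧
        IntegrableOn (loadPGFIntegrand lamB lamP mbar
          (fun r v => 1 - marcumQ1 (v / σ) (r / σ)) θ) (Ioi 0) ∧
        ∫ ω, θ ^ discLoad Φ A ω ∂μ =
          ∫ r in Ioi (0 : ℝ), loadPGFIntegrand lamB lamP mbar
            (fun r v => 1 - marcumQ1 (v / σ) (r / σ)) θ r) ∧
    (∀ R : ℝ, 0 < R → IsMaternClusterProcess Φ lamP mbar R μ →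
      (∀ (z : Plane) (r : ℝ), 0 ≤ r →
        (volume.withDensity fun s => ENNReal.ofReal (maternPDF R s)).real {s | ‖z + s‖ < r} =
          maternXi R r ‖z‖) ∧
      (∀ᵐ ω ∂μ, (discLoad Φ A ω : ℝ≥0∞) = Φ ω (Metric.ball 0 (equivRadius (A ω)))) ∧
      ∀ θ : ℂ, ‖θ‖ ≤ 1 →
        Integrable (fun ω => θ ^ discLoad Φ A ω) μ ∧
        (∀ r : ℝ, 0 < r → IntegrableOn
          (clusterIntegrand mbar (fun v => maternXi R r v) θ) (Ioi 0)) ∧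
        IntegrableOn (loadPGFIntegrand lamB lamP mbar
          (fun r v => maternXi R r v) θ) (Ioi 0) ∧
        ∫ ω, θ ^ discLoad Φ A ω ∂μ =
          ∫ r in Ioi (0 : ℝ), loadPGFIntegrand lamB lamP mbar
            (fun r v => maternXi R r v) θ r) := by
  refine ⟨fun σ hσ hΦ => ?_, fun R hR hΦ => ?_⟩
  · have hp := fun (z : Plane) (r : ℝ) (hr : 0 ≤ r) => thomasPDF_real_norm_add_lt hσ z hr
    exact ⟨hp, hΦ.ae_discLoad_eq A, fun θ hθ => IsPoissonClusterProcess.discLoad_pgf hΦ hB hA hind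
      (p := fun r v => 1 - marcumQ1 (v / σ) (r / σ)) hp hθ⟩
  · have hp := fun (z : Plane) (r : ℝ) (hr : 0 ≤ r) => maternPDF_real_norm_add_lt hR z hr
    exact ⟨hp, hΦ.ae_discLoad_eq A, fun θ hθ => IsPoissonClusterProcess.discLoad_pgf hΦ hB hA hind
      (p := maternXi R) hp hθ⟩
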